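/- Let $\beta>0$ be fixed. For $n\in\mathbb N$ and $h\in\mathbb C$ let $$Z_n(\beta,h)=\sum_{(\sigma_1,\dots,\sigma_n)\in\{\pm1\}^n}\exp\Big\{\frac{\beta}{2n}\Big(\sum_{k=1}^n\sigma_k\Big)^2+h\sum_{k=1}^n\sigma_k\Big\}$$ be the partition function of the Curie–Weiss model. For a probability measure $\mu$ on the unit circle $\mathbb T$ put $\psi_\mu(z)=\int_{\mathbb T}\frac{uz}{1-uz}\,\mu(\mathrm du)$, $|z|<1$; if $\int_{\mathbb T}u\,\mu(\mathrm du)\ne0$, then $\psi_\mu$ has an analytic inverse $\psi_\mu^{-1}$ near $0$, and the $S$-transform of $\mu$ is $S_\mu(z)=\frac{1+z}{z}\psi_\mu^{-1}(z)$. For $\sigma^2>0$ the free unitary normal distribution $\mathfrak N_{\sigma^2}$ is the probability measure on $\mathbb T$ with nonzero mean and $S_{\mathfrak N_{\sigma^2}}(z)=e^{\sigma^2(z+\frac12)}$ near $0$. Then the probability measure $\mathfrak N_{4\beta}$ exists and is unique. Moreover, there is a unique Borel measure $\nu_\beta$ on $\mathbb R$ that is invariant under the shifts $h\mapsto h+\pi\ell$,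 $\ell\in\mathbb Z$, and satisfies $\nu_\beta(A)=\mathfrak N_{4\beta}(-e^{2iA})$ for every Borel set $A\subset(-\frac\pi2,\frac\pi2]$, where $-e^{2iA}=\{-e^{2iy}:y\in A\}$. As $n\to\infty$, $$\frac1n\sum_{y\in\mathbb R:\,Z_n(\beta,iy)=0}\delta_y\longrightarrow\nu_\beta$$ vaguely on $\mathbb R$, where the zeroes are counted with multiplicities; that is, these measures are locally finite and the integrals of every continuous compactly supported function $f:\mathbb R\to\mathbb R$ converge to $\int f\,\mathrm d\nu_\beta$. -/

import Mathlib

open Filter Topology MeasureTheory Set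

noncomputable section

/-- The Curie-Weiss partition function of `n` spins at inverse temperature `β`, in the complex
external field `h`. The elements of `ℤˣ` are `1` and `-1`. -/
def curieWeissZ (n : ℕ) (β : ℝ) (h : ℂ) : ℂ :=
  ∑ σ : Fin n → ℤˣ,
    Complex.exp ((β : ℂ) / (2 * (n : ℂ)) * (∑ k, ((σ k : ℤ) : ℂ)) ^ 2
      + h * ∑ k, ((σ k : ℤ) : ℂ))

/-- The counting measure, divided by `n`, of the real numbers `y` with `Z_n(β, iy) = 0`, where each
zero is counted with its multiplicity (the order of vanishing of `h ↦ Z_n(β, h)` at `iy`). -/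
def leeYangMeasure (n : ℕ) (β : ℝ) : Measure ℝ :=
  (n : ENNReal)⁻¹ • Measure.sum
    (fun y : {y : ℝ // curieWeissZ n β (Complex.I * (y : ℂ)) = 0} =>
      (analyticOrderNatAt (curieWeissZ n β) (Complex.I * ((y : ℝ) : ℂ)) : ENNReal) •
        Measure.dirac (y : ℝ))

/-- Vague convergence of locally finite measures on the real line. -/
structure VagueTendsto (μ : ℕ → Measure ℝ) (ν : Measure ℝ) : Prop where
  locallyFinite : ∀ n, IsLocallyFiniteMeasure (μ n)
  locallyFinite_limit : IsLocallyFiniteMeasure ν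
  tendsto_integral : ∀ f : ℝ → ℝ, Continuous f → HasCompactSupport f →
    Tendsto (fun n => ∫ y, f y ∂(μ n)) atTop (𝓝 (∫ y, f y ∂ν))

instance circleMeasurableSpace : MeasurableSpace Circle := borel Circle

instance circleBorelSpace : BorelSpace Circle := ⟨rfl⟩

/-- The `ψ`-transform of a probability measure on the unit circle (used for `‖z‖ < 1`). -/
def psiTransform (μ : ProbabilityMeasure Circle) (z : ℂ) : ℂ :=
  ∫ u : Circle, ((u : ℂ) * z) / (1 - (u : ℂ) * z) ∂(μ : Measure Circle)

/-- `S` is, near the origin, the `S`-transform `w ↦ (1 + w) / w * ψ⁻¹(w)` of `μ`. The mean of `μ` is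
nonzero, and `χ` is the analytic inverse of the `ψ`-transform near the origin, which is unique as
a germ. -/
def HasSTransform (μ : ProbabilityMeasure Circle) (S : ℂ → ℂ) : Prop :=
  (∫ u : Circle, (u : ℂ) ∂(μ : Measure Circle)) ≠ 0 ∧
  ∃ χ : ℂ → ℂ, AnalyticAt ℂ χ 0 ∧ χ 0 = 0 ∧
    (∀ᶠ z in 𝓝 (0 : ℂ), χ (psiTransform μ z) = z) ∧
    (∀ᶠ w in 𝓝 (0 : ℂ), psiTransform μ (χ w) = w) ∧
    (∀ᶠ w in 𝓝[≠] (0 : ℂ), S w = (1 + w) / w * χ w)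

/-- `μ` is the free unitary normal distribution with parameter `s = σ²`: its `S`-transform is
`w ↦ exp (σ² (w + 1/2))`. -/
def IsFreeUnitaryNormal (s : ℝ) (μ : ProbabilityMeasure Circle) : Prop :=
  HasSTransform μ (fun w => Complex.exp ((s : ℂ) * (w + 1 / 2)))

/-- The map `y ↦ -exp (2iy)` from the real line to the unit circle. -/
def negExpTwo (y : ℝ) : Circle := -Circle.exp (2 * y)

/-- `ν` is invariant under all shifts by integer multiples of `π`, and on Borel subsets `A` of
`(-π/2, π/2]` it is given by `ν A = N (-exp (2iA))`. -/
def IsPeriodicPullback (N : ProbabilityMeasure Circle) (ν : Measure ℝ) : Prop :=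
  (∀ l : ℤ, ν.map (fun h => h + Real.pi * (l : ℝ)) = ν) ∧
  ∀ A : Set ℝ, MeasurableSet A → A ⊆ Ioc (-(Real.pi / 2)) (Real.pi / 2) →
    ν A = (N : Measure Circle) (negExpTwo '' A)

end

/-! Grouping configurations by the number `k` of plus spins gives `Z_n(β, h) = exp (-nh) P(-exp
(2h))`, where `P` has coefficients `exp ((2β/n) (k - n/2)²) (n choose k) (-1)^k`. So the zeroes on
the imaginary axis are governed by the unimodular roots of `P`.

All roots of `P` are unimodular (`unimodularRoots_leeYang`): this holds for `(1 - z)^n`, it is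
preserved by the multipliers `1 + c (k - n/2)²`, and the Gaussian weight is a limit of powers of
such multipliers.

Let `ψ_n(z)` be the mean of `z / (r - z)` over the roots `r`, which is the `ψ`-transform of the
empirical root measure. With `q = exp (4β/n)`, two binomial identities combine into `ψ_n(z) = z exp
(2β/n - 2β) (P(qz) / P(z)) (1 + ψ_n(qz))` (`leeYangPsi_functional`). Since `q - 1 ≈ 4β/n`, the
quotient `P(qz) / P(z)` is close to `exp (-4β ψ_n(z))`. Hence every limit `w` of `ψ_n(z)` satisfies
`z = w / (1 + w) * exp (4β (w + 1/2))` (`leeYangPsi_limit_equation`), which is the inverse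
`ψ`-transform of the free unitary normal law.

Probability measures on the circle form a compact space and the `S`-transform determines the
measure, so the root measures converge and the limit law exists (`exists_tendsto_rootProbability`).
Weak convergence on the circle becomes vague convergence on the line by summing test functions over
the fibres of `negExpTwo` (`integral_periodicPullback`, `leeYangMeasure_eq_periodicPullback`). -/

/-! ### Polynomials with unimodular roots and multipliers that preserve them. -/

open Polynomial in
/-- The polynomial with coefficients `a 0, …, a n`. -/
noncomputable def coeffPoly (n : ℕ) (a : ℕ → ℂ) : ℂ[X] := ∑ k ∈ Finset.range (n + 1), C (a k) * X ^ k

theorem coeffPoly_eval (n : ℕ) (a : ℕ → ℂ) (z : ℂ) :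
    (coeffPoly n a).eval z = ∑ k ∈ Finset.range (n + 1), a k * z ^ k := by
  simp [coeffPoly, Polynomial.eval_finsetSum]

theorem coeffPoly_coeff (n : ℕ) (a : ℕ → ℂ) (k : ℕ) :
    (coeffPoly n a).coeff k = if k ≤ n then a k else 0 := by
  simp [coeffPoly, Polynomial.finsetSum_coeff, Polynomial.coeff_X_pow]

theorem coeffPoly_natDegree {n : ℕ} {a : ℕ → ℂ} (h : a n ≠ 0) : (coeffPoly n a).natDegree = n := by
  apply le_antisymm
  · rw [Polynomial.natDegree_le_iff_coeff_eq_zero]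
    intro k hk
    rw [coeffPoly_coeff, if_neg (by omega)]
  · apply Polynomial.le_natDegree_of_ne_zero
    rwa [coeffPoly_coeff, if_pos le_rfl]

theorem coeffPoly_leadingCoeff {n : ℕ} {a : ℕ → ℂ} (h : a n ≠ 0) :
    (coeffPoly n a).leadingCoeff = a n := by
  rw [Polynomial.leadingCoeff, coeffPoly_natDegree h, coeffPoly_coeff, if_pos le_rfl]

theorem coeffPoly_ne_zero {n : ℕ} {a : ℕ → ℂ} (h : a n ≠ 0) : coeffPoly n a ≠ 0 := by
  rw [← Polynomial.leadingCoeff_ne_zero, coeffPoly_leadingCoeff h]; exact h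

theorem card_roots_coeffPoly {n : ℕ} {a : ℕ → ℂ} (h : a n ≠ 0) :
    Multiset.card (coeffPoly n a).roots = n := by
  rw [← (IsAlgClosed.splits (coeffPoly n a)).natDegree_eq_card_roots, coeffPoly_natDegree h]

/-- The polynomial with coefficients `a 0, …, a n` has exact degree `n` and all its roots lie on the
unit circle. -/
def UnimodularRoots (n : ℕ) (a : ℕ → ℂ) : Prop :=
  a n ≠ 0 ∧ ∀ z ∈ (coeffPoly n a).roots, ‖z‖ = 1

theorem UnimodularRoots.eval_ne_zero {n : ℕ} {a : ℕ → ℂ} (h : UnimodularRoots n a) {z : ℂ}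
    (hz : ‖z‖ ≠ 1) : (coeffPoly n a).eval z ≠ 0 := fun h0 =>
  hz (h.2 z ((Polynomial.mem_roots (coeffPoly_ne_zero h.1)).2 h0))

theorem abs_norm_sub_one_pow_le_norm_prod (z : ℂ) (s : Multiset ℂ) (hs : ∀ r ∈ s, ‖r‖ = 1) :
    |‖z‖ - 1| ^ (Multiset.card s) ≤ ‖(s.map (fun r => z - r)).prod‖ := by
  induction s using Multiset.induction with
  | empty => simp
  | cons a s ih =>
    rw [Multiset.map_cons, Multiset.prod_cons, norm_mul, Multiset.card_cons, pow_succ, mul_comm]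
    have h1 : |‖z‖ - 1| ≤ ‖z - a‖ := by
      have := abs_norm_sub_norm_le z a
      rwa [hs a (Multiset.mem_cons_self a s)] at this
    exact mul_le_mul h1 (ih fun r hr => hs r (Multiset.mem_cons_of_mem hr)) (by positivity)
      (by positivity)

theorem UnimodularRoots.lower_bound {n : ℕ} {a : ℕ → ℂ} (h : UnimodularRoots n a) (z : ℂ) :
    ‖a n‖ * |‖z‖ - 1| ^ n ≤ ‖(coeffPoly n a).eval z‖ := by
  rw [(IsAlgClosed.splits (coeffPoly n a)).eval_eq_prod_roots, norm_mul,
    coeffPoly_leadingCoeff h.1]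
  have := abs_norm_sub_one_pow_le_norm_prod z _ h.2
  rw [card_roots_coeffPoly h.1] at this
  gcongr

/-- A substitute for Hurwitz's theorem: `UnimodularRoots.lower_bound` passes to the limit, so the
limit polynomial cannot vanish off the circle. -/
theorem UnimodularRoots.of_tendsto {n : ℕ} {a : ℕ → ℕ → ℂ} {b : ℕ → ℂ}
    (ha : ∀ᶠ N in atTop, UnimodularRoots n (a N))
    (hab : ∀ k, Tendsto (fun N => a N k) atTop (𝓝 (b k))) (hb : b n ≠ 0) :
    UnimodularRoots n b := by
  refine ⟨hb, fun z hz => ?_⟩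
  have h0 : (coeffPoly n b).eval z = 0 := (Polynomial.mem_roots (coeffPoly_ne_zero hb)).1 hz
  have h1 : Tendsto (fun N => ‖(coeffPoly n (a N)).eval z‖) atTop
      (𝓝 ‖(coeffPoly n b).eval z‖) := by
    simp only [coeffPoly_eval]
    exact (tendsto_finsetSum _ fun k _ => (hab k).mul_const _).norm
  have h2 := le_of_tendsto_of_tendsto ((hab n).norm.mul_const (|‖z‖ - 1| ^ n)) h1
    (ha.mono fun N hN => hN.lower_bound z)
  rw [h0, norm_zero] at h2
  have h3 : |‖z‖ - 1| ^ n ≤ 0 := by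
    by_contra! h
    exact absurd h2 (not_le.2 (mul_pos (norm_pos_iff.2 hb) h))
  have h4 : |‖z‖ - 1| = 0 := eq_zero_of_pow_eq_zero (le_antisymm h3 (by positivity))
  linarith [abs_eq_zero.1 h4]

/-- The Möbius map `z ↦ z / (z - r)` sends the unit circle to the line `Re = 1/2`. The side of that
line depends only on whether `z` is inside or outside the circle, not on `r`. -/
theorem re_div_sub_unimodular {z r : ℂ} (hr : ‖r‖ = 1) (hz : ‖z‖ ≠ 1) :
    (z / (z - r)).re - 1 / 2 = (‖z‖ ^ 2 - 1) / (2 * ‖z - r‖ ^ 2) := by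
  have hne : z - r ≠ 0 := fun h => hz (by rw [sub_eq_zero.1 h, hr])
  have h0 : ‖z - r‖ ^ 2 ≠ 0 := by simpa using hne
  have hr2 : r.re * r.re + r.im * r.im = 1 := by
    rw [← Complex.normSq_apply, Complex.normSq_eq_norm_sq, hr]; norm_num
  rw [Complex.div_re]
  simp only [Complex.normSq_eq_norm_sq]
  rw [← add_div, div_sub_div _ _ h0 two_ne_zero, div_eq_div_iff (by positivity) (by positivity)]
  simp only [← Complex.normSq_eq_norm_sq, Complex.normSq_apply, Complex.sub_re, Complex.sub_im]
  linear_combination (-(((z.re - r.re) * (z.re - r.re) + (z.im - r.im) * (z.im - r.im)) * 2)) * hr2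

theorem multiset_sum_pos_of_forall {s : Multiset ℂ} {f : ℂ → ℝ} (hs : s ≠ 0)
    (hf : ∀ r ∈ s, 0 < f r) : 0 < (s.map f).sum := by
  induction s using Multiset.induction with
  | empty => exact absurd rfl hs
  | cons a s ih =>
    rw [Multiset.map_cons, Multiset.sum_cons]
    have h1 := hf a (Multiset.mem_cons_self a s)
    by_cases h : s = 0
    · simpa [h] using h1
    · linarith [ih h fun r hr => hf r (Multiset.mem_cons_of_mem hr)]

theorem sum_re_ne_half_card {z : ℂ} (s : Multiset ℂ) (hs : ∀ r ∈ s, ‖r‖ = 1) (hz : ‖z‖ ≠ 1)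
    (h0 : s ≠ 0) : (s.map fun r => (z / (z - r)).re - 1 / 2).sum ≠ 0 := by
  rw [Multiset.map_congr rfl fun r hr => re_div_sub_unimodular (hs r hr) hz]
  have hpos : ∀ r ∈ s, 0 < 2 * ‖z - r‖ ^ 2 := fun r hr => by
    have hne : z - r ≠ 0 := fun h => hz (by rw [sub_eq_zero.1 h, hs r hr])
    have := norm_pos_iff.2 hne
    positivity
  rcases lt_or_gt_of_ne hz with h | h
  · have := multiset_sum_pos_of_forall (f := fun r => -((‖z‖ ^ 2 - 1) / (2 * ‖z - r‖ ^ 2))) h0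
      fun r hr => by
        rw [← neg_div]
        exact div_pos (by nlinarith [norm_nonneg z]) (hpos r hr)
    rw [Multiset.sum_map_neg] at this
    linarith
  · exact (multiset_sum_pos_of_forall h0 fun r hr =>
      div_pos (by nlinarith [norm_nonneg z]) (hpos r hr)).ne'

theorem coeffPoly_eval_mul_derivative (n : ℕ) (a : ℕ → ℂ) (z : ℂ) :
    z * (coeffPoly n a).derivative.eval z =
      ∑ k ∈ Finset.range (n + 1), (k : ℂ) * a k * z ^ k := by
  simp only [coeffPoly, Polynomial.derivative_sum, Polynomial.eval_finsetSum, Finset.mul_sum]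
  refine Finset.sum_congr rfl fun k _ => ?_
  rcases k with _ | k
  · simp
  · rw [Polynomial.derivative_C_mul, Polynomial.derivative_X_pow]
    simp only [Polynomial.eval_mul, Polynomial.eval_C, Polynomial.eval_pow, Polynomial.eval_X,
      Nat.add_sub_cancel, Nat.cast_succ, pow_succ, map_add, map_one]
    simp
    ring

/-- The multiplier is the operator `z d/dz - n/2 - it`. A zero of the new polynomial off the circle
would give `z p'/p = n/2 + it`, so the `n` terms `z / (z - r)` would have real parts averaging
`1/2`, although all lie strictly on one side of it. For `n = 0` the imaginary part gives the
contradiction. -/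
theorem UnimodularRoots.shift {n : ℕ} {a : ℕ → ℂ} (h : UnimodularRoots n a) {t : ℝ} (ht : t ≠ 0) :
    UnimodularRoots n (fun k => ((k : ℂ) - n / 2 - t * Complex.I) * a k) := by
  have hlead : ((n : ℂ) - n / 2 - t * Complex.I) * a n ≠ 0 := by
    refine mul_ne_zero (fun h0 => ht ?_) h.1
    have := congrArg Complex.im h0
    have h2 : ((n : ℂ) / 2).im = 0 := by
      have : ((n : ℂ) / 2) = ((n / 2 : ℝ) : ℂ) := by push_cast; rfl
      rw [this, Complex.ofReal_im]
    simpa [h2] using this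
  refine ⟨hlead, fun z hz => ?_⟩
  by_contra hz1
  have hev := (Polynomial.mem_roots (coeffPoly_ne_zero
    (a := fun k => ((k : ℂ) - n / 2 - t * Complex.I) * a k) hlead)).1 hz
  have hp := h.eval_ne_zero hz1
  have key : z * (coeffPoly n a).derivative.eval z
      = (n / 2 + t * Complex.I) * (coeffPoly n a).eval z := by
    rw [Polynomial.IsRoot, coeffPoly_eval] at hev
    rw [coeffPoly_eval_mul_derivative, coeffPoly_eval, Finset.mul_sum, ← sub_eq_zero,
      ← Finset.sum_sub_distrib, ← hev]
    refine Finset.sum_congr rfl fun k _ => by ring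
  have h3 : ((coeffPoly n a).roots.map fun r => z / (z - r)).sum = n / 2 + t * Complex.I := by
    have := (IsAlgClosed.splits (coeffPoly n a)).eval_derivative_div_eval_of_ne_zero hp
    rw [← mul_div_cancel_right₀ ((n : ℂ) / 2 + t * Complex.I) hp, ← key, mul_div_assoc, this,
      ← Multiset.sum_map_mul_left]
    simp only [mul_one_div]
  by_cases h0 : (coeffPoly n a).roots = 0
  · have hn : n = 0 := by rw [← card_roots_coeffPoly h.1, h0]; rfl
    rw [h0] at h3
    have := congrArg Complex.im h3
    simp [hn] at this
    exact ht this.symm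
  · apply sum_re_ne_half_card _ h.2 hz1 h0
    rw [Multiset.sum_map_sub, Multiset.map_const', Multiset.sum_replicate,
      card_roots_coeffPoly h.1]
    have h4 := congrArg Complex.reAddGroupHom h3
    rw [map_multiset_sum, Multiset.map_map] at h4
    have h2 : ((n : ℂ) / 2).re = n / 2 := by
      have : ((n : ℂ) / 2) = ((n / 2 : ℝ) : ℂ) := by push_cast; rfl
      rw [this, Complex.ofReal_re]
    simp [h2] at h4
    have h5 : ((coeffPoly n a).roots.map fun r => (z / (z - r)).re).sum = n / 2 := by
      rw [← h4]
    rw [h5]; simp; ring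

theorem UnimodularRoots.const_mul {n : ℕ} {a : ℕ → ℂ} (h : UnimodularRoots n a) {c : ℂ}
    (hc : c ≠ 0) : UnimodularRoots n (fun k => c * a k) := by
  have hp : coeffPoly n (fun k => c * a k) = Polynomial.C c * coeffPoly n a := by
    simp only [coeffPoly, Finset.mul_sum, Polynomial.C_mul, mul_assoc]
  refine ⟨mul_ne_zero hc h.1, fun z hz => h.2 z ?_⟩
  rwa [hp, Polynomial.roots_C_mul _ hc] at hz

theorem UnimodularRoots.one_add_mul_sq {n : ℕ} {a : ℕ → ℂ} (h : UnimodularRoots n a) {c : ℝ}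
    (hc : 0 < c) : UnimodularRoots n (fun k => ((1 + c * ((k : ℝ) - n / 2) ^ 2 : ℝ) : ℂ) * a k) := by
  -- Factor `1 + c x² = c (x - it) (x + it)` with `t = c^(-1/2)` and apply both shifts.
  have hs : 0 < Real.sqrt c⁻¹ := Real.sqrt_pos.2 (inv_pos.2 hc)
  have h1 := ((h.shift hs.ne').shift (neg_ne_zero.2 hs.ne')).const_mul
    (Complex.ofReal_ne_zero.2 hc.ne')
  convert h1 using 2 with k
  have h2 : ((Real.sqrt c⁻¹ : ℝ) : ℂ) ^ 2 = (c : ℂ)⁻¹ := by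
    rw [← Complex.ofReal_pow, Real.sq_sqrt (inv_pos.2 hc).le, Complex.ofReal_inv]
  have hc' : (c : ℂ) ≠ 0 := Complex.ofReal_ne_zero.2 hc.ne'
  have h3 : (c : ℂ) * ((Real.sqrt c⁻¹ : ℝ) : ℂ) ^ 2 = 1 := by rw [h2, mul_inv_cancel₀ hc']
  push_cast
  linear_combination (-a k) * h3 + c * a k * ((Real.sqrt c⁻¹ : ℝ) : ℂ) ^ 2 * (Complex.I_sq)

theorem UnimodularRoots.exp_mul_sq {n : ℕ} {a : ℕ → ℂ} (h : UnimodularRoots n a) {c : ℝ}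
    (hc : 0 < c) : UnimodularRoots n (fun k => (Real.exp (c * ((k : ℝ) - n / 2) ^ 2) : ℂ) * a k) := by
  have hpow : ∀ (d : ℝ), 0 < d → ∀ N : ℕ, UnimodularRoots n
      (fun k => ((1 + d * ((k : ℝ) - n / 2) ^ 2 : ℝ) : ℂ) ^ N * a k) := by
    intro d hd N
    induction N with
    | zero => simpa using h
    | succ N ih =>
      convert ih.one_add_mul_sq hd using 2 with k
      rw [pow_succ]; ring
  refine UnimodularRoots.of_tendsto (a := fun N k =>
    ((1 + (c / N) * ((k : ℝ) - n / 2) ^ 2 : ℝ) : ℂ) ^ N * a k) ?_ (fun k => ?_) ?_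
  · filter_upwards [eventually_gt_atTop 0] with N hN
    exact hpow _ (div_pos hc (Nat.cast_pos.2 hN)) N
  · refine Tendsto.mul_const _ ?_
    have h1 := Real.tendsto_one_add_div_pow_exp (c * ((k : ℝ) - n / 2) ^ 2)
    have h2 := (Complex.continuous_ofReal.tendsto _).comp h1
    refine h2.congr fun N => ?_
    simp only [Function.comp_apply, Complex.ofReal_pow]
    rw [div_mul_eq_mul_div]
  · exact mul_ne_zero (Complex.ofReal_ne_zero.2 (Real.exp_pos _).ne') h.1

theorem unimodularRoots_choose (n : ℕ) :
    UnimodularRoots n (fun k => (n.choose k : ℂ) * (-1) ^ k) := by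
  refine ⟨by simp, fun z hz => ?_⟩
  have h := (Polynomial.mem_roots (coeffPoly_ne_zero
    (a := fun k => (n.choose k : ℂ) * (-1) ^ k) (n := n) (by simp))).1 hz
  rw [Polynomial.IsRoot, coeffPoly_eval] at h
  have h1 : (1 - z) ^ n = 0 := by
    rw [← h, sub_eq_neg_add, add_pow]
    refine Finset.sum_congr rfl fun k _ => ?_
    rw [neg_pow z k, one_pow]; ring
  have h2 : 1 - z = 0 := eq_zero_of_pow_eq_zero h1
  rw [← sub_eq_zero.1 h2, norm_one]

/-! ### The Lee–Yang polynomial of the Curie–Weiss model. -/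

/-- The coefficients of the Lee-Yang polynomial of the Curie-Weiss model. -/
noncomputable def leeYangCoeff (n : ℕ) (β : ℝ) (k : ℕ) : ℝ :=
  Real.exp (2 * β / n * ((k : ℝ) - n / 2) ^ 2) * ((n.choose k : ℝ) * (-1) ^ k)

/-- The polynomial `P` with `Z_n(β, h) = exp (-nh) P(-exp (2h))`. -/
noncomputable def leeYangPoly (n : ℕ) (β : ℝ) : Polynomial ℂ :=
  coeffPoly n (fun k => (leeYangCoeff n β k : ℂ))

theorem unimodularRoots_leeYang {n : ℕ} (hn : n ≠ 0) {β : ℝ} (hβ : 0 < β) :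
    UnimodularRoots n (fun k => (leeYangCoeff n β k : ℂ)) := by
  convert (unimodularRoots_choose n).exp_mul_sq (c := 2 * β / n) (by positivity) using 2 with k
  simp [leeYangCoeff]

/-- Induction on `n` by conditioning on the first spin; the two values of that spin produce the two
terms of Pascal's rule. -/
theorem sum_spins {n : ℕ} (g : ℤ → ℂ) :
    ∑ σ : Fin n → ℤˣ, g (∑ k, (σ k : ℤ)) =
      ∑ k ∈ Finset.range (n + 1), (n.choose k : ℂ) * g (2 * k - n) := by
  induction n generalizing g with
  | zero => simp
  | succ n ih =>
    rw [← (Fin.consEquiv (fun _ : Fin (n + 1) => ℤˣ)).sum_comp, Fintype.sum_prod_type]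
    simp only [Fin.consEquiv_apply, Fin.sum_univ_succ, Fin.cons_zero, Fin.cons_succ]
    have huniv : (Finset.univ : Finset ℤˣ) = {1, -1} := rfl
    rw [huniv, Finset.sum_pair (by decide), ih (fun m => g (((1 : ℤˣ) : ℤ) + m)),
      ih (fun m => g (((-1 : ℤˣ) : ℤ) + m)), Finset.sum_range_succ' _ (n + 1)]
    simp only [Nat.choose_succ_succ, Nat.cast_add, add_mul, Finset.sum_add_distrib]
    rw [add_assoc]
    congr 1
    · refine Finset.sum_congr rfl fun k _ => ?_
      congr 2; push_cast; ring
    · have h1 := Finset.sum_range_succ' (fun k => (n.choose k : ℂ) * g (2 * k - n - 1)) (n + 1)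
      have h2 := Finset.sum_range_succ (fun k => (n.choose k : ℂ) * g (2 * k - n - 1)) (n + 1)
      rw [h2] at h1
      simp only [Nat.choose_succ_self, Nat.cast_zero, zero_mul, add_zero] at h1
      convert h1 using 1
      · refine Finset.sum_congr rfl fun k _ => ?_
        congr 2; push_cast; ring
      · congr 1
        · refine Finset.sum_congr rfl fun k _ => ?_
          congr 2; push_cast; ring
        · simp; congr 1; ring

/-- With `k` plus spins the total spin is `2k - n`. The sign `(-1)^k` of the coefficient cancels the
one from `(-exp (2h))^k`. -/
theorem curieWeissZ_eq {n : ℕ} (hn : n ≠ 0) (β : ℝ) (h : ℂ) :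
    curieWeissZ n β h =
      Complex.exp (-(n * h)) * (leeYangPoly n β).eval (-Complex.exp (2 * h)) := by
  have h1 := sum_spins (n := n) fun m =>
    Complex.exp ((β : ℂ) / (2 * (n : ℂ)) * (m : ℂ) ^ 2 + h * (m : ℂ))
  push_cast at h1
  rw [← curieWeissZ] at h1
  have hn' : (n : ℂ) ≠ 0 := Nat.cast_ne_zero.2 hn
  rw [h1, leeYangPoly, coeffPoly_eval, Finset.mul_sum]
  refine Finset.sum_congr rfl fun k _ => ?_
  rw [leeYangCoeff, neg_pow (Complex.exp (2 * h)), ← Complex.exp_nat_mul]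
  push_cast
  have h3 : ((-1 : ℂ) ^ k) * (-1) ^ k = 1 := by rw [← mul_pow]; simp
  have h4 : Complex.exp ((β : ℂ) / (2 * n) * (2 * k - n) ^ 2 + h * (2 * k - n)) =
      Complex.exp (-(n * h)) * (Complex.exp (2 * β / n * (k - n / 2) ^ 2) *
        Complex.exp (k * (2 * h))) := by
    rw [← Complex.exp_add, ← Complex.exp_add]
    congr 1
    field_simp
    ring
  rw [h4]
  linear_combination (-(n.choose k : ℂ) * (Complex.exp (-(n * h)) *
    (Complex.exp (2 * β / n * (k - n / 2) ^ 2) * Complex.exp (k * (2 * h))))) * h3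

/-! ### The `ψ`- and `S`-transforms determine a measure on the circle. -/

theorem Circle.continuous_val : Continuous fun u : Circle => (u : ℂ) := continuous_subtype_val

theorem Circle.one_sub_mul_ne_zero (u : Circle) {z : ℂ} (hz : ‖z‖ < 1) : 1 - (u : ℂ) * z ≠ 0 := by
  intro h
  have h1 : ‖(u : ℂ) * z‖ = 1 := by rw [← sub_eq_zero.1 h, norm_one]
  rw [norm_mul, Circle.norm_coe, one_mul] at h1
  exact hz.ne h1

theorem Circle.norm_kernel_le (u : Circle) {z : ℂ} (hz : ‖z‖ < 1) :
    ‖((u : ℂ) * z) / (1 - (u : ℂ) * z)‖ ≤ ‖z‖ / (1 - ‖z‖) := by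
  rw [norm_div, norm_mul, Circle.norm_coe, one_mul]
  have h1 : 1 - ‖z‖ ≤ ‖1 - (u : ℂ) * z‖ := by
    have := norm_sub_norm_le (1 : ℂ) ((u : ℂ) * z)
    rwa [norm_one, norm_mul, Circle.norm_coe, one_mul] at this
  have h2 : 0 < 1 - ‖z‖ := by linarith
  gcongr

theorem Circle.continuous_kernel {z : ℂ} (hz : ‖z‖ < 1) :
    Continuous fun u : Circle => ((u : ℂ) * z) / (1 - (u : ℂ) * z) :=
  (Circle.continuous_val.mul continuous_const).div
    (continuous_const.sub (Circle.continuous_val.mul continuous_const))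
    fun u => Circle.one_sub_mul_ne_zero u hz

theorem Circle.integrable_of_continuous (μ : Measure Circle) [IsFiniteMeasure μ] {E : Type*}
    [NormedAddCommGroup E] [SecondCountableTopology E] {f : Circle → E} (hf : Continuous f) :
    Integrable f μ :=
  hf.integrable_of_hasCompactSupport (HasCompactSupport.of_compactSpace f)

theorem norm_psiTransform_le (μ : ProbabilityMeasure Circle) {z : ℂ} (hz : ‖z‖ < 1) :
    ‖psiTransform μ z‖ ≤ ‖z‖ / (1 - ‖z‖) := by
  have := norm_integral_le_of_norm_le_const (μ := (μ : Measure Circle))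
    (Eventually.of_forall fun u : Circle => Circle.norm_kernel_le u hz)
  simpa [psiTransform] using this

/-- Termwise integration of the geometric series. Adding `1` supplies the zeroth moment, so all
coefficients have one formula. -/
theorem hasSum_one_add_psiTransform (μ : ProbabilityMeasure Circle) {z : ℂ} (hz : ‖z‖ < 1) :
    HasSum (fun k : ℕ => z ^ k • ∫ u : Circle, (u : ℂ) ^ k ∂(μ : Measure Circle))
      (1 + psiTransform μ z) := by
  have h1 : 1 + psiTransform μ z = ∫ u : Circle, (1 - (u : ℂ) * z)⁻¹ ∂(μ : Measure Circle) := by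
    have : (1 : ℂ) = ∫ _u : Circle, (1 : ℂ) ∂(μ : Measure Circle) := by simp
    rw [psiTransform]
    nth_rewrite 1 [this]
    rw [← integral_add (integrable_const _)
      (Circle.integrable_of_continuous _ (Circle.continuous_kernel hz))]
    refine integral_congr_ae (Eventually.of_forall fun u => ?_)
    have := Circle.one_sub_mul_ne_zero u hz
    field_simp
    ring
  have h2 : ∀ k : ℕ, z ^ k • ∫ u : Circle, (u : ℂ) ^ k ∂(μ : Measure Circle) =
      ∫ u : Circle, ((u : ℂ) * z) ^ k ∂(μ : Measure Circle) := fun k => by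
    rw [smul_eq_mul, ← integral_const_mul]
    exact integral_congr_ae (Eventually.of_forall fun u => by simp [mul_pow, mul_comm])
  simp only [h2]
  rw [h1]
  have h3 : ∀ u : Circle, (1 - (u : ℂ) * z)⁻¹ = ∑' k : ℕ, ((u : ℂ) * z) ^ k := fun u =>
    (tsum_geometric_of_norm_lt_one (by rw [norm_mul, Circle.norm_coe, one_mul]; exact hz)).symm
  simp only [h3]
  refine hasSum_integral_of_summable_integral_norm (fun k => ?_) ?_
  · exact Circle.integrable_of_continuous _
      ((Circle.continuous_val.mul continuous_const).pow k)
  · simp only [norm_pow, norm_mul, Circle.norm_coe, one_mul, integral_const, probReal_univ,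
      smul_eq_mul]
    exact summable_geometric_of_lt_one (norm_nonneg z) hz

theorem hasFPowerSeriesAt_psiTransform (μ : ProbabilityMeasure Circle) :
    HasFPowerSeriesAt (fun z => 1 + psiTransform μ z)
      (FormalMultilinearSeries.ofScalars ℂ
        (fun k => ∫ u : Circle, (u : ℂ) ^ k ∂(μ : Measure Circle))) 0 := by
  rw [hasFPowerSeriesAt_iff]
  filter_upwards [Metric.ball_mem_nhds (0 : ℂ) one_pos] with z hz
  simp only [FormalMultilinearSeries.coeff_ofScalars, zero_add]
  exact hasSum_one_add_psiTransform μ (by simpa using hz)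

theorem psiTransform_zero (μ : ProbabilityMeasure Circle) : psiTransform μ 0 = 0 := by
  simp [psiTransform]

theorem hasDerivAt_psiTransform (μ : ProbabilityMeasure Circle) :
    HasDerivAt (psiTransform μ) (∫ u : Circle, (u : ℂ) ∂(μ : Measure Circle)) 0 := by
  have := (hasFPowerSeriesAt_psiTransform μ).hasDerivAt
  simpa using (hasDerivAt_const_add_iff (1 : ℂ)).1 this

theorem tendsto_psiTransform_zero (μ : ProbabilityMeasure Circle) :
    Tendsto (psiTransform μ) (𝓝 0) (𝓝 0) := by
  have := (hasDerivAt_psiTransform μ).continuousAt.tendsto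
  rwa [psiTransform_zero] at this

/-- A probability measure on the circle is determined by its moments. -/
theorem Circle.probabilityMeasure_ext {μ ν : ProbabilityMeasure Circle}
    (h : ∀ k : ℕ, ∫ u : Circle, (u : ℂ) ^ k ∂(μ : Measure Circle) =
      ∫ u : Circle, (u : ℂ) ^ k ∂(ν : Measure Circle)) : μ = ν := by
  have hz : ∀ k : ℤ, ∫ u : Circle, (u : ℂ) ^ k ∂(μ : Measure Circle) =
      ∫ u : Circle, (u : ℂ) ^ k ∂(ν : Measure Circle) := by
    intro k
    rcases Int.eq_nat_or_neg k with ⟨m, rfl | rfl⟩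
    · simpa using h m
    · have hc : ∀ u : Circle, (u : ℂ) ^ (-(m : ℤ)) = starRingEnd ℂ ((u : ℂ) ^ m) := fun u => by
        rw [map_pow, ← Circle.coe_inv_eq_conj, Circle.coe_inv, zpow_neg, zpow_natCast, inv_pow]
      simp only [hc, integral_conj, h m]
  let ι : BoundedContinuousFunction Circle ℂ :=
    BoundedContinuousFunction.mkOfCompact ⟨fun u : Circle => (u : ℂ), Circle.continuous_val⟩
  apply Subtype.ext
  -- The star algebra generated by the coordinate function separates points and is spanned by the
  -- integer powers of `u`, whose integrals agree by `hz`.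
  refine ext_of_forall_mem_subalgebra_integral_eq_of_polish
    (P := (μ : Measure Circle)) (P' := (ν : Measure Circle)) (A := StarAlgebra.adjoin ℂ {ι}) ?_ ?_
  · intro x y hxy
    refine ⟨fun u : Circle => (u : ℂ), ⟨ContinuousMap.mk (fun u : Circle => (u : ℂ))
      Circle.continuous_val, ?_, rfl⟩, fun h => hxy (Circle.ext h)⟩
    exact ⟨ι, StarAlgebra.subset_adjoin ℂ _ (mem_singleton ι), rfl⟩
  · intro g hg
    have hg' : g ∈ (StarAlgebra.adjoin ℂ {ι}).toSubalgebra := hg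
    rw [StarAlgebra.adjoin_toSubalgebra, ← Subalgebra.mem_toSubmodule,
      Algebra.adjoin_eq_span] at hg'
    clear hg
    induction hg' using Submodule.span_induction with
    | mem x hx =>
      have : ∃ k : ℤ, ∀ u : Circle, x u = (u : ℂ) ^ k := by
        induction hx using Submonoid.closure_induction with
        | mem x hx =>
          rcases hx with hx | hx
          · exact ⟨1, fun u => by rw [mem_singleton_iff.1 hx]; simp [ι]⟩
          · refine ⟨-1, fun u => ?_⟩
            have hx' : x = star ι := by rw [← mem_singleton_iff.1 hx, star_star]
            rw [hx', BoundedContinuousFunction.star_apply, zpow_neg_one, ← Circle.coe_inv,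
              Circle.coe_inv_eq_conj]
            rfl
        | one => exact ⟨0, fun u => by simp⟩
        | mul x y _ _ hx hy =>
          obtain ⟨a, ha⟩ := hx
          obtain ⟨b, hb⟩ := hy
          exact ⟨a + b, fun u => by
            rw [BoundedContinuousFunction.mul_apply, ha, hb, zpow_add₀ (Circle.coe_ne_zero u)]⟩
      obtain ⟨k, hk⟩ := this
      simp only [hk]
      exact hz k
    | zero => simp
    | add x y _ _ hx hy =>
      simp only [BoundedContinuousFunction.add_apply]
      rw [integral_add (Circle.integrable_of_continuous _ x.continuous)
        (Circle.integrable_of_continuous _ y.continuous), integral_add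
        (Circle.integrable_of_continuous _ x.continuous)
        (Circle.integrable_of_continuous _ y.continuous), hx, hy]
    | smul c x _ hx =>
      simp only [BoundedContinuousFunction.smul_apply]
      rw [integral_smul, integral_smul, hx]

theorem eq_of_psiTransform_eventuallyEq {μ ν : ProbabilityMeasure Circle}
    (h : psiTransform μ =ᶠ[𝓝 0] psiTransform ν) : μ = ν := by
  refine Circle.probabilityMeasure_ext fun k => ?_
  have h1 := (hasFPowerSeriesAt_psiTransform μ).congr
    (g := fun z => 1 + psiTransform ν z) (h.mono fun z hz => by simp only [hz])
  have h2 := h1.eq_formalMultilinearSeries (hasFPowerSeriesAt_psiTransform ν)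
  have h3 := congrArg (fun p => FormalMultilinearSeries.coeff p k) h2
  simpa only [FormalMultilinearSeries.coeff_ofScalars] using h3

/-- A probability measure on the circle is determined by its `S`-transform. -/
theorem HasSTransform.unique {μ ν : ProbabilityMeasure Circle} {S : ℂ → ℂ}
    (hμ : HasSTransform μ S) (hν : HasSTransform ν S) : μ = ν := by
  obtain ⟨-, χ, -, hχ0, -, hχr, hχS⟩ := hμ
  obtain ⟨-, ξ, -, hξ0, hξl, -, hξS⟩ := hν
  have hne : ∀ᶠ w in 𝓝 (0 : ℂ), 1 + w ≠ 0 :=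
    (continuous_const.add continuous_id).continuousAt.eventually_ne (by simp)
  have heq : ∀ᶠ w in 𝓝 (0 : ℂ), χ w = ξ w := by
    rw [eventually_nhdsWithin_iff] at hχS hξS
    filter_upwards [hχS, hξS, hne] with w h1 h2 h3
    by_cases hw : w = 0
    · rw [hw, hχ0, hξ0]
    · exact mul_left_cancel₀ (div_ne_zero h3 hw) ((h1 hw).symm.trans (h2 hw))
  apply eq_of_psiTransform_eventuallyEq
  -- The inverses `χ` and `ξ` agree near `0`, so `ψ_μ(z) = ψ_μ(ξ(ψ_ν(z))) = ψ_μ(χ(ψ_ν(z))) =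
  -- ψ_ν(z)`.
  filter_upwards [hξl, (tendsto_psiTransform_zero ν).eventually hχr,
    (tendsto_psiTransform_zero ν).eventually heq] with z h1 h2 h3
  rw [h3, h1] at h2
  exact h2

/-- The inverse `ψ`-transform of the free unitary normal distribution. -/
noncomputable def freeUnitaryInv (s : ℝ) (w : ℂ) : ℂ :=
  w / (1 + w) * Complex.exp ((s : ℂ) * (w + 1 / 2))

theorem analyticAt_freeUnitaryInv (s : ℝ) : AnalyticAt ℂ (freeUnitaryInv s) 0 := by
  unfold freeUnitaryInv
  refine (analyticAt_id.div (analyticAt_const.add analyticAt_id) (by simp)).mul ?_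
  exact (analyticAt_const.mul (analyticAt_id.add analyticAt_const)).cexp

theorem hasDerivAt_freeUnitaryInv (s : ℝ) :
    HasDerivAt (freeUnitaryInv s) (Complex.exp ((s : ℂ) * (1 / 2))) 0 := by
  have h1 : HasDerivAt (fun w : ℂ => w / (1 + w)) 1 0 := by
    have := (hasDerivAt_id (0 : ℂ)).div ((hasDerivAt_id (0 : ℂ)).const_add 1) (by simp)
    simp only [id, sub_zero, mul_one, add_zero, one_pow, div_one] at this
    exact this
  have h2 : DifferentiableAt ℂ (fun w : ℂ => Complex.exp ((s : ℂ) * (w + 1 / 2))) 0 := by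
    fun_prop
  have := h1.mul h2.hasDerivAt
  simp only [zero_add, one_mul, zero_div, zero_mul, add_zero] at this
  exact this

/-- A left inverse suffices. The chain rule forces the mean to be nonzero, and `freeUnitaryInv s` is
locally injective, having derivative `exp (s/2)` at `0`, so the left inverse is also a right
inverse. -/
theorem isFreeUnitaryNormal_of_eventually {s : ℝ} {μ : ProbabilityMeasure Circle}
    (h : ∀ᶠ z in 𝓝 (0 : ℂ), freeUnitaryInv s (psiTransform μ z) = z) :
    IsFreeUnitaryNormal s μ := by
  have h0 : freeUnitaryInv s 0 = 0 := by simp [freeUnitaryInv]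
  have hd := hasDerivAt_freeUnitaryInv s
  refine ⟨fun hm => ?_, freeUnitaryInv s, analyticAt_freeUnitaryInv s, h0, h, ?_, ?_⟩
  · have hψ := hasDerivAt_psiTransform μ
    rw [hm] at hψ
    have hd' : HasDerivAt (freeUnitaryInv s) (Complex.exp ((s : ℂ) * (1 / 2)))
        (psiTransform μ 0) := by rwa [psiTransform_zero]
    have h1 := hd'.comp 0 hψ
    have h2 : HasDerivAt (fun z : ℂ => z) 1 0 := hasDerivAt_id 0
    have h3 := (h1.congr_of_eventuallyEq (h.mono fun z hz => hz.symm)).unique h2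
    simp at h3
  · have hs : HasStrictDerivAt (freeUnitaryInv s) (Complex.exp ((s : ℂ) * (1 / 2))) 0 := by
      have := (analyticAt_freeUnitaryInv s).hasStrictDerivAt
      rwa [hd.deriv] at this
    have hinj := hs.eventually_left_inverse (Complex.exp_ne_zero _)
    have hχ : Tendsto (freeUnitaryInv s) (𝓝 0) (𝓝 0) := by
      have := hd.continuousAt.tendsto
      rwa [h0] at this
    filter_upwards [hinj, hχ.eventually h, ((tendsto_psiTransform_zero μ).comp hχ).eventually hinj]
      with w h1 h2 h3
    simp only [Function.comp_apply] at h3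
    rw [← h3, h2, h1]
  · have hne : ∀ᶠ w in 𝓝 (0 : ℂ), 1 + w ≠ 0 :=
      (continuous_const.add continuous_id).continuousAt.eventually_ne (by simp)
    rw [eventually_nhdsWithin_iff]
    filter_upwards [hne] with w h1 (h2 : w ≠ 0)
    rw [freeUnitaryInv]
    field_simp

/-! ### The functional equation for `leeYangPsi` and its limit. -/

/-- Replacing one factor `1 + x` by `exp x` costs at most `δ²`. With `n` factors and `δ` of order
`1/n` the total error is of order `1/n`. The second bound is carried along for the induction. -/
theorem norm_prod_one_add_sub_exp_le {ι : Type*} (s : Multiset ι) (x : ι → ℂ) {δ : ℝ}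
    (hδ : δ ≤ 1) (hx : ∀ r ∈ s, ‖x r‖ ≤ δ) :
    ‖(s.map fun r => 1 + x r).prod - Complex.exp (s.map x).sum‖ ≤
      Multiset.card s * δ ^ 2 * Real.exp (Multiset.card s * δ) ∧
    ‖Complex.exp (s.map x).sum‖ ≤ Real.exp (Multiset.card s * δ) := by
  induction s using Multiset.induction with
  | empty => simp
  | cons a s ih =>
    obtain ⟨h1, h2⟩ := ih fun r hr => hx r (Multiset.mem_cons_of_mem hr)
    have ha := hx a (Multiset.mem_cons_self a s)
    have hδ0 : 0 ≤ δ := (norm_nonneg _).trans ha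
    simp only [Multiset.map_cons, Multiset.prod_cons, Multiset.sum_cons, Multiset.card_cons,
      Complex.exp_add]
    set P := (s.map fun r => 1 + x r).prod
    set E := Complex.exp (s.map x).sum
    have hexp : Real.exp ((Multiset.card s + 1 : ℕ) * δ) =
        Real.exp δ * Real.exp (Multiset.card s * δ) := by
      rw [← Real.exp_add]; push_cast; ring_nf
    have h3 : ‖Complex.exp (x a)‖ ≤ Real.exp δ :=
      (Complex.norm_exp_le_exp_norm _).trans (Real.exp_le_exp.2 ha)
    have h4 : ‖1 + x a‖ ≤ Real.exp δ := by
      calc ‖1 + x a‖ ≤ 1 + ‖x a‖ := by simpa using norm_add_le (1 : ℂ) (x a)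
        _ ≤ δ + 1 := by linarith
        _ ≤ _ := Real.add_one_le_exp δ
    have h5 : ‖1 + x a - Complex.exp (x a)‖ ≤ δ ^ 2 := by
      rw [norm_sub_rev, ← sub_sub]
      refine (Complex.norm_exp_sub_one_sub_id_le (ha.trans hδ)).trans ?_
      gcongr
    have h6 : 1 ≤ Real.exp δ := Real.one_le_exp hδ0
    constructor
    · have : (1 + x a) * P - Complex.exp (x a) * E =
          (1 + x a) * (P - E) + (1 + x a - Complex.exp (x a)) * E := by ring
      rw [this, hexp]
      calc _ ≤ ‖1 + x a‖ * ‖P - E‖ + ‖1 + x a - Complex.exp (x a)‖ * ‖E‖ := by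
            rw [← norm_mul, ← norm_mul]; exact norm_add_le _ _
        _ ≤ Real.exp δ * (Multiset.card s * δ ^ 2 * Real.exp (Multiset.card s * δ)) +
            δ ^ 2 * Real.exp (Multiset.card s * δ) := by gcongr
        _ ≤ Real.exp δ * (Multiset.card s * δ ^ 2 * Real.exp (Multiset.card s * δ)) +
            Real.exp δ * (δ ^ 2 * Real.exp (Multiset.card s * δ)) := by
              exact add_le_add le_rfl (le_mul_of_one_le_left (by positivity) h6)
        _ = _ := by push_cast; ring
    · rw [norm_mul, hexp]
      gcongr

theorem norm_multiset_sum_map_le {ι : Type*} (s : Multiset ι) (x : ι → ℂ) {C : ℝ}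
    (hx : ∀ r ∈ s, ‖x r‖ ≤ C) : ‖(s.map x).sum‖ ≤ Multiset.card s * C := by
  refine (norm_multiset_sum_le _).trans ?_
  rw [Multiset.map_map]
  have := Multiset.sum_le_card_nsmul (s.map (norm ∘ x)) C (by
    intro y hy
    obtain ⟨r, hr, rfl⟩ := Multiset.mem_map.1 hy
    exact hx r hr)
  simpa using this

theorem half_le_norm_sub {r z : ℂ} (hr : ‖r‖ = 1) (hz : ‖z‖ ≤ 1 / 2) : 1 / 2 ≤ ‖r - z‖ := by
  have := norm_sub_norm_le r z
  linarith

theorem norm_div_sub_le_one {r z : ℂ} (hr : ‖r‖ = 1) (hz : ‖z‖ ≤ 1 / 2) : ‖z / (r - z)‖ ≤ 1 := by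
  have h := half_le_norm_sub hr hz
  rw [norm_div, div_le_one (by linarith)]
  linarith

theorem norm_div_sub_sub_div_sub_le {r z w : ℂ} (hr : ‖r‖ = 1) (hz : ‖z‖ ≤ 1 / 2)
    (hw : ‖w‖ ≤ 1 / 2) : ‖w / (r - w) - z / (r - z)‖ ≤ 4 * ‖w - z‖ := by
  have h1 := half_le_norm_sub hr hz
  have h2 := half_le_norm_sub hr hw
  have n1 : r - z ≠ 0 := norm_pos_iff.1 (by linarith)
  have n2 : r - w ≠ 0 := norm_pos_iff.1 (by linarith)
  have : w / (r - w) - z / (r - z) = r * (w - z) / ((r - w) * (r - z)) := by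
    field_simp; ring
  rw [this, norm_div, norm_mul, norm_mul, hr, one_mul, div_le_iff₀ (by positivity)]
  have h3 : 1 / 4 ≤ ‖r - w‖ * ‖r - z‖ := by nlinarith
  nlinarith [norm_nonneg (w - z)]

/-- The average of `z / (r - z)` over the roots `r` of the Lee-Yang polynomial. -/
noncomputable def leeYangPsi (n : ℕ) (β : ℝ) (z : ℂ) : ℂ :=
  (n : ℂ)⁻¹ * ((leeYangPoly n β).roots.map fun r => z / (r - z)).sum

theorem card_roots_leeYangPoly {n : ℕ} (hn : n ≠ 0) {β : ℝ} (hβ : 0 < β) :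
    Multiset.card (leeYangPoly n β).roots = n :=
  card_roots_coeffPoly (unimodularRoots_leeYang hn hβ).1

theorem norm_root_leeYangPoly {n : ℕ} (hn : n ≠ 0) {β : ℝ} (hβ : 0 < β) :
    ∀ r ∈ (leeYangPoly n β).roots, ‖r‖ = 1 := (unimodularRoots_leeYang hn hβ).2

theorem leeYangPoly_ne_zero {n : ℕ} (hn : n ≠ 0) {β : ℝ} (hβ : 0 < β) : leeYangPoly n β ≠ 0 :=
  coeffPoly_ne_zero (unimodularRoots_leeYang hn hβ).1

theorem leeYangPoly_eval_ne_zero {n : ℕ} (hn : n ≠ 0) {β : ℝ} (hβ : 0 < β) {z : ℂ}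
    (hz : ‖z‖ ≠ 1) : (leeYangPoly n β).eval z ≠ 0 :=
  (unimodularRoots_leeYang hn hβ).eval_ne_zero hz

theorem norm_leeYangPsi_sub_le {n : ℕ} (hn : n ≠ 0) {β : ℝ} (hβ : 0 < β) {z w : ℂ}
    (hz : ‖z‖ ≤ 1 / 2) (hw : ‖w‖ ≤ 1 / 2) :
    ‖leeYangPsi n β w - leeYangPsi n β z‖ ≤ 4 * ‖w - z‖ := by
  rw [leeYangPsi, leeYangPsi, ← mul_sub, ← Multiset.sum_map_sub, norm_mul, norm_inv,
    Complex.norm_natCast]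
  have h := norm_multiset_sum_map_le (leeYangPoly n β).roots
    (fun r => w / (r - w) - z / (r - z)) (C := 4 * ‖w - z‖)
    fun r hr => norm_div_sub_sub_div_sub_le (norm_root_leeYangPoly hn hβ r hr) hz hw
  rw [card_roots_leeYangPoly hn hβ] at h
  rw [inv_mul_le_iff₀ (by positivity)]
  exact h

/-- The sum defining `leeYangPsi` is, up to sign, `z` times the logarithmic derivative of the
polynomial. -/
theorem leeYangPoly_mul_leeYangPsi {n : ℕ} (hn : n ≠ 0) {β : ℝ} (hβ : 0 < β) {z : ℂ}
    (hz : ‖z‖ ≠ 1) :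
    n * ((leeYangPoly n β).eval z * leeYangPsi n β z) =
      -(z * (leeYangPoly n β).derivative.eval z) := by
  have hp := leeYangPoly_eval_ne_zero hn hβ hz
  have hn' : (n : ℂ) ≠ 0 := Nat.cast_ne_zero.2 hn
  have h1 := (IsAlgClosed.splits (leeYangPoly n β)).eval_derivative_div_eval_of_ne_zero hp
  rw [div_eq_iff hp] at h1
  rw [leeYangPsi, h1]
  have h2 : ((leeYangPoly n β).roots.map fun r => z / (r - z)).sum =
      -(z * ((leeYangPoly n β).roots.map fun r => 1 / (z - r)).sum) := by
    rw [← Multiset.sum_map_mul_left, ← Multiset.sum_map_neg]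
    refine congrArg _ (Multiset.map_congr rfl fun r _ => ?_)
    rw [mul_one_div, ← div_neg, neg_sub]
  rw [h2]
  field_simp

/-- The value at `z` of the auxiliary polynomial of degree `m`, with the inverse temperature scaled
for `m + 1` spins. -/
noncomputable def leeYangAux (m : ℕ) (β : ℝ) (z : ℂ) : ℂ :=
  ∑ k ∈ Finset.range (m + 1),
    (Real.exp (2 * β / (m + 1 : ℕ) * ((k : ℝ) - (m + 1 : ℕ) / 2) ^ 2) : ℂ) *
      ((m.choose k : ℂ) * (-1) ^ k) * z ^ k

/-- With `n = m + 1`, this is `(n - k) (n choose k) = n (m choose k)` coefficientwise. -/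
theorem leeYangPoly_sub_derivative (m : ℕ) (β : ℝ) (z : ℂ) :
    ((m + 1 : ℕ) : ℂ) * (leeYangPoly (m + 1) β).eval z -
      z * (leeYangPoly (m + 1) β).derivative.eval z = ((m + 1 : ℕ) : ℂ) * leeYangAux m β z := by
  rw [leeYangPoly, coeffPoly_eval_mul_derivative, coeffPoly_eval, Finset.mul_sum,
    ← Finset.sum_sub_distrib, Finset.sum_range_succ, leeYangAux, Finset.mul_sum]
  rw [← add_zero (∑ k ∈ Finset.range (m + 1), ((m + 1 : ℕ) : ℂ) * _)]
  congr 1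
  · refine Finset.sum_congr rfl fun k hk => ?_
    have hk' : k ≤ m + 1 := (Finset.mem_range.1 hk).le
    have h := congrArg (fun x : ℕ => (x : ℂ)) (Nat.choose_mul_succ_eq m k)
    simp only [Nat.cast_mul, Nat.cast_sub hk'] at h
    rw [leeYangCoeff]
    push_cast at h ⊢
    linear_combination (-(Complex.exp (2 * β / (m + 1) * ((k : ℂ) - (m + 1) / 2) ^ 2) *
      (-1) ^ k * z ^ k)) * h
  · ring

/-- Here `(k + 1) (n choose k + 1) = n (m choose k)` with `n = m + 1`. Moving the Gaussian weight
from `k` to `k + 1` multiplies it by a constant times `q^k`, `q = exp (4β/n)`, which dilates the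
argument of the same auxiliary polynomial. -/
theorem leeYangPoly_derivative_eq (m : ℕ) (β : ℝ) (z : ℂ) :
    -(z * (leeYangPoly (m + 1) β).derivative.eval z) =
      ((m + 1 : ℕ) : ℂ) * (z * Real.exp (2 * β / (m + 1 : ℕ) - 2 * β) *
        leeYangAux m β (Real.exp (4 * β / (m + 1 : ℕ)) * z)) := by
  rw [leeYangPoly, coeffPoly_eval_mul_derivative, Finset.sum_range_succ', leeYangAux,
    Finset.mul_sum, Finset.mul_sum]
  simp only [Nat.cast_zero, zero_mul, add_zero]
  rw [← Finset.sum_neg_distrib]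
  refine Finset.sum_congr rfl fun k _ => ?_
  have h := congrArg (fun x : ℕ => (x : ℂ)) (Nat.add_one_mul_choose_eq m k)
  simp only [Nat.cast_mul] at h
  have he : Real.exp (2 * β / (m + 1 : ℕ) * (((k + 1 : ℕ) : ℝ) - (m + 1 : ℕ) / 2) ^ 2) =
      Real.exp (2 * β / (m + 1 : ℕ) - 2 * β) *
      Real.exp (2 * β / (m + 1 : ℕ) * ((k : ℝ) - (m + 1 : ℕ) / 2) ^ 2) *
      Real.exp (4 * β / (m + 1 : ℕ)) ^ k := by
    rw [← Real.exp_nat_mul, ← Real.exp_add, ← Real.exp_add]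
    congr 1
    have : ((m + 1 : ℕ) : ℝ) ≠ 0 := by positivity
    field_simp
    push_cast
    ring
  rw [leeYangCoeff, he, mul_pow]
  simp only [Complex.ofReal_mul, Complex.ofReal_pow, Complex.ofReal_neg, Complex.ofReal_one,
    Complex.ofReal_natCast]
  rw [pow_succ (-1 : ℂ) k, pow_succ z k]
  generalize ((Real.exp (2 * β / (m + 1 : ℕ) - 2 * β) : ℝ) : ℂ) = A
  generalize ((Real.exp (2 * β / (m + 1 : ℕ) * ((k : ℝ) - (m + 1 : ℕ) / 2) ^ 2) : ℝ) : ℂ) = B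
  generalize ((Real.exp (4 * β / (m + 1 : ℕ)) : ℝ) : ℂ) = C
  linear_combination (-(A * B * C ^ k * (-1) ^ k * z ^ k * z)) * h

/-- Eliminate `leeYangAux` at `qz` between the two preceding identities, the first taken at `qz` and
the second at `z`. -/
theorem leeYangPsi_functional {m : ℕ} {β : ℝ} (hβ : 0 < β) {z : ℂ} (hz : ‖z‖ ≠ 1)
    (hqz : ‖(Real.exp (4 * β / (m + 1 : ℕ)) : ℂ) * z‖ ≠ 1) :
    leeYangPsi (m + 1) β z = z * Real.exp (2 * β / (m + 1 : ℕ) - 2 * β) *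
      ((leeYangPoly (m + 1) β).eval (Real.exp (4 * β / (m + 1 : ℕ)) * z) /
        (leeYangPoly (m + 1) β).eval z) *
      (1 + leeYangPsi (m + 1) β (Real.exp (4 * β / (m + 1 : ℕ)) * z)) := by
  have hn : m + 1 ≠ 0 := m.succ_ne_zero
  have hn' : ((m + 1 : ℕ) : ℂ) ≠ 0 := Nat.cast_ne_zero.2 hn
  have hp := leeYangPoly_eval_ne_zero hn hβ hz
  have h1 := leeYangPoly_mul_leeYangPsi hn hβ hz
  rw [leeYangPoly_derivative_eq] at h1
  have h2 := leeYangPoly_mul_leeYangPsi hn hβ hqz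
  have h3 := leeYangPoly_sub_derivative m β (Real.exp (4 * β / (m + 1 : ℕ)) * z)
  rw [sub_eq_add_neg, ← h2, ← mul_add] at h3
  have h4 := mul_left_cancel₀ hn' h1
  have h5 := mul_left_cancel₀ hn' h3
  rw [← h5] at h4
  generalize (leeYangPoly (m + 1) β).eval (Real.exp (4 * β / (m + 1 : ℕ)) * z) = P at *
  generalize leeYangPsi (m + 1) β (Real.exp (4 * β / (m + 1 : ℕ)) * z) = Ψ at *
  generalize (Real.exp (2 * β / (m + 1 : ℕ) - 2 * β) : ℂ) = A at *
  field_simp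
  linear_combination h4

theorem norm_leeYangPoly_ratio_sub_exp_le {n : ℕ} (hn : n ≠ 0) {β : ℝ} (hβ : 0 < β) {z : ℂ}
    (hz : ‖z‖ ≤ 1 / 2) {ε : ℝ} (hε : 0 ≤ ε) (hε1 : ε ≤ 1) :
    ‖(leeYangPoly n β).eval (((1 + ε : ℝ) : ℂ) * z) / (leeYangPoly n β).eval z -
      Complex.exp (-((n * ε : ℝ) * leeYangPsi n β z))‖ ≤ n * ε ^ 2 * Real.exp (n * ε) := by
  have hroot := norm_root_leeYangPoly hn hβ
  have hn' : (n : ℂ) ≠ 0 := Nat.cast_ne_zero.2 hn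
  have hp := leeYangPoly_ne_zero hn hβ
  -- Each root contributes `((1 + ε) z - r) / (z - r) = 1 - ε z / (r - z)`.
  have h1 : (leeYangPoly n β).eval (((1 + ε : ℝ) : ℂ) * z) / (leeYangPoly n β).eval z =
      ((leeYangPoly n β).roots.map fun r => 1 + -(ε * (z / (r - z)))).prod := by
    rw [(IsAlgClosed.splits (leeYangPoly n β)).eval_eq_prod_roots,
      (IsAlgClosed.splits (leeYangPoly n β)).eval_eq_prod_roots,
      mul_div_mul_left _ _ (Polynomial.leadingCoeff_ne_zero.2 hp), ← Multiset.prod_map_div]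
    refine congrArg _ (Multiset.map_congr rfl fun r hr => ?_)
    have h := half_le_norm_sub (hroot r hr) hz
    have n1 : r - z ≠ 0 := norm_pos_iff.1 (by linarith)
    have n2 : z - r ≠ 0 := by rw [← neg_sub]; exact neg_ne_zero.2 n1
    rw [div_eq_iff n2, ← neg_sub r z]
    field_simp
    push_cast
    ring
  have h2 : -((n * ε : ℝ) * leeYangPsi n β z) =
      ((leeYangPoly n β).roots.map fun r => -(ε * (z / (r - z)))).sum := by
    rw [Multiset.sum_map_neg, Multiset.sum_map_mul_left, leeYangPsi]
    push_cast
    field_simp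
  have h3 := (norm_prod_one_add_sub_exp_le (leeYangPoly n β).roots
    (fun r => -(ε * (z / (r - z)))) hε1 fun r hr => by
      rw [norm_neg, norm_mul, Complex.norm_of_nonneg hε]
      exact mul_le_of_le_one_right hε (norm_div_sub_le_one (hroot r hr) hz)).1
  rw [card_roots_leeYangPoly hn hβ] at h3
  rw [h1, h2]
  exact h3

theorem tendsto_nat_mul_exp_sub_one (c : ℝ) :
    Tendsto (fun m : ℕ => ((m + 1 : ℕ) : ℝ) * (Real.exp (c / (m + 1 : ℕ)) - 1)) atTop (𝓝 c) := by
  have h0 : HasDerivAt (fun x : ℝ => Real.exp (c * x)) c 0 := by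
    have := ((hasDerivAt_id (0 : ℝ)).const_mul c).exp
    simpa using this
  have h1 := hasDerivAt_iff_tendsto_slope_zero.1 h0
  have h2 : Tendsto (fun m : ℕ => (((m + 1 : ℕ) : ℝ))⁻¹) atTop (𝓝[≠] 0) := by
    rw [tendsto_nhdsWithin_iff]
    refine ⟨?_, Eventually.of_forall fun m => by simp; positivity⟩
    exact tendsto_inv_atTop_zero.comp
      (tendsto_natCast_atTop_atTop.comp (tendsto_add_atTop_nat 1))
  refine (h1.comp h2).congr fun m => ?_
  simp [div_eq_mul_inv]

theorem tendsto_exp_div_nat (c : ℝ) :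
    Tendsto (fun m : ℕ => Real.exp (c / (m + 1 : ℕ))) atTop (𝓝 1) := by
  have h : Tendsto (fun m : ℕ => c / ((m + 1 : ℕ) : ℝ)) atTop (𝓝 0) :=
    (tendsto_natCast_atTop_atTop.comp (tendsto_add_atTop_nat 1)).const_div_atTop c
  have h1 := (Real.continuous_exp.tendsto 0).comp h
  rwa [Real.exp_zero] at h1

/-- The filter `l` is arbitrary so that ultrafilters can be used later. The radius `1/4` keeps `qz`
in the disc of radius `1/2` once `q ≤ 2`. -/
theorem leeYangPsi_limit_equation {β : ℝ} (hβ : 0 < β) {z w : ℂ} (hz : ‖z‖ ≤ 1 / 4)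
    {l : Filter ℕ} [l.NeBot] (hl : l ≤ atTop)
    (hw : Tendsto (fun m => leeYangPsi (m + 1) β z) l (𝓝 w)) :
    w = z * Complex.exp (-(2 * β)) * Complex.exp (-(4 * β * w)) * (1 + w) := by
  have hq : Tendsto (fun m : ℕ => Real.exp (4 * β / (m + 1 : ℕ))) l (𝓝 1) :=
    (tendsto_exp_div_nat (4 * β)).mono_left hl
  have hnε : Tendsto (fun m : ℕ => ((m + 1 : ℕ) : ℝ) * (Real.exp (4 * β / (m + 1 : ℕ)) - 1)) l
      (𝓝 (4 * β)) := (tendsto_nat_mul_exp_sub_one (4 * β)).mono_left hl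
  have hq2 : ∀ᶠ m in l, Real.exp (4 * β / (m + 1 : ℕ)) ≤ 2 := hq.eventually_le_const one_lt_two
  have hq1 : ∀ m : ℕ, 1 ≤ Real.exp (4 * β / (m + 1 : ℕ)) := fun m =>
    Real.one_le_exp (by positivity)
  have hz2 : ‖z‖ ≤ 1 / 2 := by linarith
  have hqz : ∀ᶠ m in l, ‖(Real.exp (4 * β / (m + 1 : ℕ)) : ℂ) * z‖ ≤ 1 / 2 := by
    filter_upwards [hq2] with m hm
    rw [norm_mul, Complex.norm_of_nonneg (Real.exp_pos _).le]
    nlinarith [norm_nonneg z, Real.exp_pos (4 * β / (m + 1 : ℕ))]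
  have hD : Tendsto (fun m : ℕ => (leeYangPoly (m + 1) β).eval
      (Real.exp (4 * β / (m + 1 : ℕ)) * z) / (leeYangPoly (m + 1) β).eval z) l
      (𝓝 (Complex.exp (-(4 * β * w)))) := by
    have h1 : Tendsto (fun m : ℕ => Complex.exp
        (-((((m + 1 : ℕ) : ℝ) * (Real.exp (4 * β / (m + 1 : ℕ)) - 1) : ℝ) *
          leeYangPsi (m + 1) β z))) l (𝓝 (Complex.exp (-(4 * β * w)))) := by
      refine (Complex.continuous_exp.tendsto _).comp (Tendsto.neg (Tendsto.mul ?_ hw))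
      have := (Complex.continuous_ofReal.tendsto _).comp hnε
      rw [Complex.ofReal_mul, Complex.ofReal_ofNat] at this
      exact this
    have h2 : Tendsto (fun m : ℕ => ((m + 1 : ℕ) : ℝ) * (Real.exp (4 * β / (m + 1 : ℕ)) - 1) ^ 2 *
        Real.exp (((m + 1 : ℕ) : ℝ) * (Real.exp (4 * β / (m + 1 : ℕ)) - 1))) l (𝓝 0) := by
      have := (hnε.mul (hq.sub_const 1)).mul ((Real.continuous_exp.tendsto _).comp hnε)
      simp only [sub_self, mul_zero, zero_mul] at this
      refine this.congr fun m => ?_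
      simp only [Function.comp_apply]
      ring
    have h3 := squeeze_zero_norm' (a := fun m : ℕ => ((m + 1 : ℕ) : ℝ) *
        (Real.exp (4 * β / (m + 1 : ℕ)) - 1) ^ 2 *
        Real.exp (((m + 1 : ℕ) : ℝ) * (Real.exp (4 * β / (m + 1 : ℕ)) - 1)))
      (f := fun m : ℕ => (leeYangPoly (m + 1) β).eval
      (Real.exp (4 * β / (m + 1 : ℕ)) * z) / (leeYangPoly (m + 1) β).eval z -
        Complex.exp (-((((m + 1 : ℕ) : ℝ) * (Real.exp (4 * β / (m + 1 : ℕ)) - 1) : ℝ) *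
          leeYangPsi (m + 1) β z))) (by
        filter_upwards [hq2] with m hm
        have := norm_leeYangPoly_ratio_sub_exp_le m.succ_ne_zero hβ hz2
          (ε := Real.exp (4 * β / (m + 1 : ℕ)) - 1) (by linarith [hq1 m]) (by linarith)
        rwa [add_sub_cancel] at this) h2
    simpa using h3.add h1
  have hψ : Tendsto (fun m : ℕ => leeYangPsi (m + 1) β (Real.exp (4 * β / (m + 1 : ℕ)) * z)) l
      (𝓝 w) := by
    have h1 : Tendsto (fun m : ℕ => 4 * ‖(Real.exp (4 * β / (m + 1 : ℕ)) : ℂ) * z - z‖) l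
        (𝓝 0) := by
      have := ((((Complex.continuous_ofReal.tendsto _).comp hq).mul_const z).sub_const z).norm
      simpa using this.const_mul 4
    have h2 := squeeze_zero_norm' (hqz.mono fun m hm =>
      norm_leeYangPsi_sub_le m.succ_ne_zero hβ hz2 hm) h1
    simpa using h2.add hw
  have hc : Tendsto (fun m : ℕ => z * (Real.exp (2 * β / (m + 1 : ℕ) - 2 * β) : ℂ)) l
      (𝓝 (z * Complex.exp (-(2 * β)))) := by
    refine Tendsto.const_mul z ?_
    have h1 := ((tendsto_exp_div_nat (2 * β)).mono_left hl).mul_const (Real.exp (-(2 * β)))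
    have h2 := (Complex.continuous_ofReal.tendsto _).comp h1
    simp only [one_mul, Complex.ofReal_exp, Complex.ofReal_neg, Complex.ofReal_mul,
      Complex.ofReal_ofNat] at h2
    refine h2.congr fun m => ?_
    rw [Function.comp_apply, ← Real.exp_add, sub_eq_add_neg]
  refine tendsto_nhds_unique hw ((hc.mul hD |>.mul (hψ.const_add 1)).congr' ?_)
  filter_upwards [hqz] with m hm
  exact (leeYangPsi_functional hβ (by linarith : ‖z‖ < 1).ne (by linarith : _ < (1 : ℝ)).ne).symm

/-! ### Empirical root measures and their weak limit. -/

theorem roots_leeYangPoly_map_conj (n : ℕ) (β : ℝ) :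
    (leeYangPoly n β).roots.map (starRingEnd ℂ) = (leeYangPoly n β).roots := by
  rw [← (IsAlgClosed.splits (leeYangPoly n β)).roots_map]
  congr 1
  ext k
  rw [Polynomial.coeff_map, leeYangPoly, coeffPoly_coeff]
  split_ifs <;> simp

/-- For unimodular `r`, `z / (r - z)` equals `r̄ z / (1 - r̄ z)`, and the multiset of roots is
invariant under conjugation. This is the form of the kernel of `psiTransform`. -/
theorem leeYangPsi_eq_sum {n : ℕ} (hn : n ≠ 0) {β : ℝ} (hβ : 0 < β) {z : ℂ} :
    leeYangPsi n β z =
      (n : ℂ)⁻¹ * ((leeYangPoly n β).roots.map fun r => r * z / (1 - r * z)).sum := by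
  rw [leeYangPsi]
  nth_rewrite 1 [← roots_leeYangPoly_map_conj]
  rw [Multiset.map_map]
  congr 2
  refine Multiset.map_congr rfl fun r hr => ?_
  have h1 := norm_root_leeYangPoly hn hβ r hr
  have h2 : r * starRingEnd ℂ r = 1 := by rw [Complex.mul_conj']; simp [h1]
  have h0 : r ≠ 0 := norm_pos_iff.1 (by rw [h1]; exact one_pos)
  simp only [Function.comp_apply]
  rw [← mul_div_mul_left z _ h0, mul_sub, h2]

/-- The projection of a nonzero complex number to the unit circle. -/
noncomputable def circleProj (r : ℂ) : Circle := Circle.exp (Complex.arg r)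

theorem coe_circleProj {r : ℂ} (hr : ‖r‖ = 1) : (circleProj r : ℂ) = r := by
  have := Complex.norm_mul_exp_arg_mul_I r
  rw [hr, Complex.ofReal_one, one_mul] at this
  rw [circleProj, Circle.coe_exp, this]

/-- The empirical measure of the roots of the Lee-Yang polynomial. -/
noncomputable def rootMeasure (n : ℕ) (β : ℝ) : Measure Circle :=
  (n : ENNReal)⁻¹ • ∑ r ∈ (leeYangPoly n β).roots.toFinset,
    ((leeYangPoly n β).roots.count r : ENNReal) • Measure.dirac (circleProj r)

theorem isProbabilityMeasure_rootMeasure {n : ℕ} (hn : n ≠ 0) {β : ℝ} (hβ : 0 < β) :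
    IsProbabilityMeasure (rootMeasure n β) := by
  constructor
  have h := (leeYangPoly n β).roots.toFinset_sum_count_eq
  rw [card_roots_leeYangPoly hn hβ] at h
  simp only [rootMeasure, Measure.smul_apply, Measure.finsetSum_apply, measure_univ,
    smul_eq_mul, mul_one]
  rw [← Nat.cast_sum, h]
  exact ENNReal.inv_mul_cancel (by simpa using hn) (by simp)

theorem integral_rootMeasure (n : ℕ) (β : ℝ) (f : Circle → ℂ) (hf : Continuous f) :
    ∫ u, f u ∂(rootMeasure n β) =
      (n : ℂ)⁻¹ * ((leeYangPoly n β).roots.map fun r => f (circleProj r)).sum := by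
  rw [rootMeasure, integral_smul_measure, integral_finsetSum_measure, Finset.sum_multiset_map_count]
  · simp [integral_smul_measure]
  · intro r _
    exact (Circle.integrable_of_continuous _ hf).smul_measure (by simp)

/-- The empirical measure of the roots of the Lee-Yang polynomial for `m + 1` spins, as a
probability measure. -/
noncomputable def rootProbability {β : ℝ} (hβ : 0 < β) (m : ℕ) : ProbabilityMeasure Circle :=
  ⟨rootMeasure (m + 1) β, isProbabilityMeasure_rootMeasure m.succ_ne_zero hβ⟩

theorem psiTransform_rootProbability {β : ℝ} (hβ : 0 < β) (m : ℕ) {z : ℂ} (hz : ‖z‖ < 1) :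
    psiTransform (rootProbability hβ m) z = leeYangPsi (m + 1) β z := by
  rw [leeYangPsi_eq_sum m.succ_ne_zero hβ]
  refine (integral_rootMeasure (m + 1) β _ (Circle.continuous_kernel hz)).trans ?_
  congr 2
  refine Multiset.map_congr rfl fun r hr => ?_
  rw [coe_circleProj (norm_root_leeYangPoly m.succ_ne_zero hβ r hr)]

theorem tendsto_psiTransform {ι : Type*} {l : Filter ι} {μ : ι → ProbabilityMeasure Circle}
    {ν : ProbabilityMeasure Circle} (h : Tendsto μ l (𝓝 ν)) {z : ℂ} (hz : ‖z‖ < 1) :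
    Tendsto (fun i => psiTransform (μ i) z) l (𝓝 (psiTransform ν z)) :=
  (ProbabilityMeasure.tendsto_iff_forall_integral_rclike_tendsto ℂ).1 h
    (BoundedContinuousFunction.mkOfCompact ⟨_, Circle.continuous_kernel hz⟩)

theorem isFreeUnitaryNormal_of_tendsto {β : ℝ} (hβ : 0 < β) {l : Filter ℕ} [l.NeBot]
    (hl : l ≤ atTop) {N : ProbabilityMeasure Circle}
    (h : Tendsto (rootProbability hβ) l (𝓝 N)) : IsFreeUnitaryNormal (4 * β) N := by
  apply isFreeUnitaryNormal_of_eventually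
  filter_upwards [Metric.ball_mem_nhds (0 : ℂ) (by norm_num : (0 : ℝ) < 1 / 4)] with z hz
  have hz4 : ‖z‖ < 1 / 4 := by simpa using hz
  have hz1 : ‖z‖ < 1 := by linarith
  have hw : Tendsto (fun m => leeYangPsi (m + 1) β z) l (𝓝 (psiTransform N z)) := by
    simpa only [psiTransform_rootProbability hβ _ hz1] using tendsto_psiTransform h hz1
  have key := leeYangPsi_limit_equation hβ hz4.le hl hw
  -- For `‖z‖ < 1/4` the bound `‖z‖ / (1 - ‖z‖)` is less than `1`.
  have hne : 1 + psiTransform N z ≠ 0 := fun h0 => by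
    have h1 := norm_psiTransform_le N hz1
    rw [eq_neg_of_add_eq_zero_right h0, norm_neg, norm_one, le_div_iff₀ (by linarith)] at h1
    linarith
  set w := psiTransform N z
  have he : Complex.exp (-(2 * β)) * Complex.exp (-(4 * β * w)) *
      Complex.exp (((4 * β : ℝ) : ℂ) * (w + 1 / 2)) = 1 := by
    rw [← Complex.exp_add, ← Complex.exp_add]
    have : -(2 * β : ℂ) + -(4 * β * w) + ((4 * β : ℝ) : ℂ) * (w + 1 / 2) = 0 := by
      push_cast
      ring
    rw [this, Complex.exp_zero]
  rw [freeUnitaryInv, div_mul_eq_mul_div, div_eq_iff hne]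
  nth_rewrite 1 [key]
  linear_combination (z * (1 + w)) * he

/-- By compactness every ultrafilter finer than `atTop` has a limit; each limit is free unitary
normal, so by uniqueness all coincide. -/
theorem exists_tendsto_rootProbability {β : ℝ} (hβ : 0 < β) :
    ∃ N : ProbabilityMeasure Circle, IsFreeUnitaryNormal (4 * β) N ∧
      Tendsto (rootProbability hβ) atTop (𝓝 N) := by
  have hex : ∀ U : Ultrafilter ℕ, (U : Filter ℕ) ≤ atTop →
      ∃ N, IsFreeUnitaryNormal (4 * β) N ∧ Tendsto (rootProbability hβ) U (𝓝 N) := by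
    intro U hU
    obtain ⟨N, -, hN⟩ := isCompact_univ.ultrafilter_le_nhds (U.map (rootProbability hβ)) (by simp)
    exact ⟨N, isFreeUnitaryNormal_of_tendsto hβ hU hN, hN⟩
  obtain ⟨N, hN, -⟩ := hex (Ultrafilter.of atTop) (Ultrafilter.of_le atTop)
  refine ⟨N, hN, ?_⟩
  rw [tendsto_iff_ultrafilter]
  intro U hU
  obtain ⟨N', hN', h⟩ := hex U hU
  rwa [HasSTransform.unique hN hN']

/-! ### Pulling measures on the circle back to periodic measures on the line. -/

/-- The preimage of `u` under `negExpTwo` in `(-π/2, π/2]`, shifted by `πl`. -/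
noncomputable def circleLift (l : ℤ) (u : Circle) : ℝ :=
  Complex.arg ((-u : Circle) : ℂ) / 2 + Real.pi * l

theorem measurable_circleLift (l : ℤ) : Measurable (circleLift l) := by
  have h : Measurable fun u : Circle => ((-u : Circle) : ℂ) :=
    (Circle.continuous_val.comp continuous_neg).measurable
  exact ((Complex.measurable_arg.comp h).div_const 2).add_const _

theorem negExpTwo_circleLift (l : ℤ) (u : Circle) : negExpTwo (circleLift l u) = u := by
  have h : 2 * circleLift l u = Complex.arg ((-u : Circle) : ℂ) + (l : ℤ) * (2 * Real.pi) := by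
    rw [circleLift]; ring
  rw [negExpTwo, h, Circle.exp_add, Circle.exp_arg, Circle.exp_int_mul_two_pi, mul_one, neg_neg]

theorem circleLift_zero_mem (u : Circle) :
    circleLift 0 u ∈ Ioc (-(Real.pi / 2)) (Real.pi / 2) := by
  have h1 := Complex.neg_pi_lt_arg ((-u : Circle) : ℂ)
  have h2 := Complex.arg_le_pi ((-u : Circle) : ℂ)
  simp only [circleLift, Int.cast_zero, mul_zero, add_zero, mem_Ioc]
  constructor <;> linarith

theorem abs_circleLift_zero_le (u : Circle) : |circleLift 0 u| ≤ Real.pi / 2 :=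
  abs_le.2 ⟨(circleLift_zero_mem u).1.le, (circleLift_zero_mem u).2⟩

theorem circleLift_eq_add (l : ℤ) (u : Circle) :
    circleLift l u = circleLift 0 u + Real.pi * l := by
  simp [circleLift]

theorem circleLift_zero_negExpTwo {y : ℝ} (hy : y ∈ Ioc (-(Real.pi / 2)) (Real.pi / 2)) :
    circleLift 0 (negExpTwo y) = y := by
  simp only [circleLift, negExpTwo, neg_neg, Int.cast_zero, mul_zero, add_zero]
  rw [Circle.arg_exp (by linarith [hy.1]) (by linarith [hy.2])]
  ring

theorem negExpTwo_add_pi_mul (y : ℝ) (l : ℤ) : negExpTwo (y + Real.pi * l) = negExpTwo y := by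
  have h : 2 * (y + Real.pi * l) = 2 * y + (l : ℤ) * (2 * Real.pi) := by ring
  rw [negExpTwo, h, Circle.exp_add, Circle.exp_int_mul_two_pi, mul_one, negExpTwo]

theorem exists_circleLift_negExpTwo (y : ℝ) : ∃ l : ℤ, circleLift l (negExpTwo y) = y := by
  obtain ⟨l, hl⟩ := mem_iUnion.1 ((iUnion_Ioc_add_zsmul Real.pi_pos (-(Real.pi / 2))).symm ▸
    mem_univ y)
  refine ⟨l, ?_⟩
  have h1 : y - Real.pi * l ∈ Ioc (-(Real.pi / 2)) (Real.pi / 2) := by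
    simp only [zsmul_eq_mul, mem_Ioc] at hl ⊢
    push_cast at hl
    constructor <;> linarith [hl.1, hl.2]
  have h2 : negExpTwo y = negExpTwo (y - Real.pi * l) := by
    rw [← negExpTwo_add_pi_mul (y - Real.pi * l) l, sub_add_cancel]
  rw [circleLift_eq_add, h2, circleLift_zero_negExpTwo h1, sub_add_cancel]

/-- The pullback of a measure on the circle under `negExpTwo`. -/
noncomputable def periodicPullback (μ : Measure Circle) : Measure ℝ :=
  Measure.sum fun l : ℤ => μ.map (circleLift l)

theorem finite_abs_pi_mul_le (C : ℝ) : {l : ℤ | |Real.pi * l| ≤ C}.Finite := by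
  refine (finite_Icc (-⌈C⌉) ⌈C⌉).subset fun l (hl : |Real.pi * l| ≤ C) => ?_
  rw [abs_mul, abs_of_pos Real.pi_pos] at hl
  have h1 : |(l : ℝ)| ≤ ⌈C⌉ := by
    have := Int.le_ceil C
    nlinarith [abs_nonneg (l : ℝ), Real.pi_gt_three]
  rw [← Int.cast_abs, Int.cast_le] at h1
  exact abs_le.1 h1

theorem isLocallyFiniteMeasure_periodicPullback (μ : Measure Circle) [IsFiniteMeasure μ] :
    IsLocallyFiniteMeasure (periodicPullback μ) := by
  refine ⟨fun y => ⟨Metric.ball y 1, Metric.ball_mem_nhds y one_pos, ?_⟩⟩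
  rw [periodicPullback, Measure.sum_apply _ Metric.isOpen_ball.measurableSet,
    tsum_eq_sum (s := (finite_abs_pi_mul_le (|y| + 1 + Real.pi / 2)).toFinset)]
  · refine ENNReal.sum_lt_top.2 fun l _ => ?_
    have := Measure.isFiniteMeasure_map μ (circleLift l)
    exact measure_lt_top _ _
  · intro l hl
    rw [Measure.map_apply (measurable_circleLift l) Metric.isOpen_ball.measurableSet]
    convert measure_empty (μ := μ)
    rw [eq_empty_iff_forall_notMem]
    intro u hu
    apply hl
    rw [Finite.mem_toFinset, mem_ofPred_eq]
    rw [mem_preimage, Metric.mem_ball, Real.dist_eq, circleLift_eq_add] at hu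
    have h1 := abs_circleLift_zero_le u
    calc |Real.pi * l| = |(circleLift 0 u + Real.pi * l - y) + y - circleLift 0 u| := by
          congr 1; ring
      _ ≤ |circleLift 0 u + Real.pi * l - y| + |y| + |circleLift 0 u| :=
          (abs_sub _ _).trans (add_le_add (abs_add_le _ _) le_rfl)
      _ ≤ _ := by linarith

theorem isPeriodicPullback_periodicPullback (N : ProbabilityMeasure Circle) :
    IsPeriodicPullback N (periodicPullback (N : Measure Circle)) := by
  constructor
  · intro k
    have hm : Measurable fun h : ℝ => h + Real.pi * (k : ℝ) := measurable_id.add_const _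
    ext s hs
    rw [Measure.map_apply hm hs, periodicPullback, Measure.sum_apply _ (hm hs),
      Measure.sum_apply _ hs, ← (Equiv.addRight k).tsum_eq fun l : ℤ =>
        (Measure.map (circleLift l) (N : Measure Circle)) s]
    refine tsum_congr fun l => ?_
    rw [Measure.map_apply (measurable_circleLift _) (hm hs),
      Measure.map_apply (measurable_circleLift _) hs, ← preimage_comp]
    congr 2
    funext u
    simp only [Function.comp_apply, circleLift, Equiv.coe_addRight, Int.cast_add]
    ring
  · intro A hA hsub
    rw [periodicPullback, Measure.sum_apply _ hA, tsum_eq_single 0]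
    · rw [Measure.map_apply (measurable_circleLift _) hA]
      congr 1
      ext u
      constructor
      · intro hu
        exact ⟨_, hu, negExpTwo_circleLift 0 u⟩
      · rintro ⟨y, hy, rfl⟩
        rw [mem_preimage, circleLift_zero_negExpTwo (hsub hy)]
        exact hy
    · intro l hl
      rw [Measure.map_apply (measurable_circleLift _) hA]
      convert measure_empty (μ := (N : Measure Circle))
      rw [eq_empty_iff_forall_notMem]
      intro u hu
      apply hl
      have h1 := hsub hu
      have h2 := circleLift_zero_negExpTwo h1
      rw [negExpTwo_circleLift, circleLift_eq_add l] at h2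
      have h3 : Real.pi * (l : ℝ) = 0 := by linarith
      simpa [Real.pi_ne_zero] using h3

/-- Cut a Borel set along the translates of `(-π/2, π/2]` by `πl` and shift each piece back to the
base interval. -/
theorem IsPeriodicPullback.unique {N : ProbabilityMeasure Circle} {ν ν' : Measure ℝ}
    (h : IsPeriodicPullback N ν) (h' : IsPeriodicPullback N ν') : ν = ν' := by
  have key : ∀ {ρ : Measure ℝ}, IsPeriodicPullback N ρ → ∀ B : Set ℝ, MeasurableSet B →
      ρ B = ∑' l : ℤ, (N : Measure Circle) (negExpTwo ''
        (((fun h : ℝ => h + Real.pi * (l : ℝ)) ⁻¹' B) ∩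
          Ioc (-(Real.pi / 2)) (Real.pi / 2))) := by
    intro ρ hρ B hB
    have hU := iUnion_Ioc_add_zsmul Real.pi_pos (-(Real.pi / 2))
    have hd := pairwise_disjoint_Ioc_add_zsmul (-(Real.pi / 2)) Real.pi
    have hBU : B = ⋃ l : ℤ, B ∩ Ioc (-(Real.pi / 2) + l • Real.pi)
        (-(Real.pi / 2) + (l + 1) • Real.pi) := by
      rw [← inter_iUnion, hU, inter_univ]
    nth_rewrite 1 [hBU]
    rw [measure_iUnion (fun i j hij => (hd hij).mono inter_subset_right inter_subset_right)
      fun l => hB.inter measurableSet_Ioc]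
    refine tsum_congr fun l => ?_
    have hm : Measurable fun h : ℝ => h + Real.pi * (l : ℝ) := measurable_id.add_const _
    rw [← hρ.2 _ ((hm hB).inter measurableSet_Ioc) inter_subset_right]
    nth_rewrite 1 [← hρ.1 l]
    rw [Measure.map_apply hm (hB.inter measurableSet_Ioc)]
    congr 1
    ext y
    simp only [mem_preimage, mem_inter_iff, mem_Ioc, zsmul_eq_mul, Int.cast_add, Int.cast_one]
    refine and_congr_right fun _ => and_congr ?_ ?_ <;> constructor <;> intro _ <;> linarith
  ext B hB
  rw [key h B hB, key h' B hB]

/-- The sum of `f` over the fibre of `negExpTwo`. -/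
noncomputable def fibreSum (f : ℝ → ℝ) (u : Circle) : ℝ := ∑ᶠ l : ℤ, f (circleLift l u)

theorem exists_support_bound {f : ℝ → ℝ} (hf : HasCompactSupport f) :
    ∃ R, ∀ y, f y ≠ 0 → |y| ≤ R := by
  obtain ⟨R, hR⟩ := hf.isCompact.isBounded.exists_norm_le
  exact ⟨R, fun y hy => hR y (subset_tsupport f hy)⟩

theorem fibreSum_negExpTwo (f : ℝ → ℝ) (y : ℝ) :
    fibreSum f (negExpTwo y) = ∑ᶠ l : ℤ, f (y + Real.pi * l) := by
  obtain ⟨k, hk⟩ := exists_circleLift_negExpTwo y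
  rw [fibreSum, ← finsum_comp_equiv (Equiv.addLeft k)]
  refine finsum_congr fun l => ?_
  nth_rewrite 2 [← hk]
  rw [circleLift_eq_add, circleLift_eq_add k, Equiv.coe_addLeft, Int.cast_add]
  ring_nf

/-- The individual lifts jump at the branch cut of `arg`, so continuity is tested after composing
with the quotient map `negExpTwo`, where the sum over shifts by `πl` is locally finite. -/
theorem continuous_fibreSum {f : ℝ → ℝ} (hf : Continuous f) (hc : HasCompactSupport f) :
    Continuous (fibreSum f) := by
  obtain ⟨R, hR⟩ := exists_support_bound hc
  have h1 : Continuous fun y : ℝ => ∑ᶠ l : ℤ, f (y + Real.pi * l) := by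
    refine continuous_finsum (fun l => hf.comp (continuous_id.add continuous_const)) fun y => ?_
    refine ⟨Metric.ball y 1, Metric.ball_mem_nhds y one_pos,
      (finite_abs_pi_mul_le (R + |y| + 1)).subset ?_⟩
    rintro l ⟨x, hx, hxy⟩
    rw [Metric.mem_ball, Real.dist_eq] at hxy
    have h2 := hR _ hx
    rw [mem_ofPred_eq]
    calc |Real.pi * l| = |(x + Real.pi * l) - (x - y) - y| := by congr 1; ring
      _ ≤ |x + Real.pi * l| + |x - y| + |y| :=
          (abs_sub _ _).trans (add_le_add (abs_sub _ _) le_rfl)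
      _ ≤ _ := by linarith
  have hq : IsOpenQuotientMap negExpTwo := by
    have ho : IsOpenQuotientMap (Circle.exp : ℝ → Circle) :=
      ⟨fun u => ⟨_, Circle.exp_arg u⟩, Circle.exp.continuous,
        isLocalHomeomorph_circleExp.isOpenMap⟩
    exact (Homeomorph.neg Circle).isOpenQuotientMap.comp
      (ho.comp (Homeomorph.mulLeft₀ (2 : ℝ) two_ne_zero).isOpenQuotientMap)
  rw [hq.isQuotientMap.continuous_iff]
  exact h1.congr fun y => (fibreSum_negExpTwo f y).symm

theorem integral_periodicPullback (μ : Measure Circle) [IsFiniteMeasure μ] {f : ℝ → ℝ}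
    (hf : Continuous f) (hc : HasCompactSupport f) :
    ∫ y, f y ∂(periodicPullback μ) = ∫ u, fibreSum f u ∂μ := by
  obtain ⟨R, hR⟩ := exists_support_bound hc
  have := isLocallyFiniteMeasure_periodicPullback μ
  have hint : Integrable f (periodicPullback μ) := hf.integrable_of_hasCompactSupport hc
  -- Only these sheets can meet the support of `f`, so sum and integral are exchanged over a finite
  -- set.
  set s := (finite_abs_pi_mul_le (R + Real.pi / 2)).toFinset with hs
  have hz : ∀ l : ℤ, l ∉ s → ∀ u, f (circleLift l u) = 0 := by
    intro l hl u
    by_contra h0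
    apply hl
    rw [hs, Finite.mem_toFinset, mem_ofPred_eq]
    have h1 := hR _ h0
    have h2 := abs_circleLift_zero_le u
    rw [circleLift_eq_add] at h1
    calc |Real.pi * l| = |(circleLift 0 u + Real.pi * l) - circleLift 0 u| := by congr 1; ring
      _ ≤ |circleLift 0 u + Real.pi * l| + |circleLift 0 u| := abs_sub _ _
      _ ≤ _ := by linarith
  have hsum : ∀ u, fibreSum f u = ∑ l ∈ s, f (circleLift l u) := fun u =>
    finsum_eq_sum_of_support_subset _ fun l hl => by
      by_contra h
      exact hl (hz l h u)
  have hmap : ∀ l : ℤ, ∫ y, f y ∂(μ.map (circleLift l)) = ∫ u, f (circleLift l u) ∂μ := fun l =>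
    integral_map (measurable_circleLift l).aemeasurable hf.aestronglyMeasurable
  have hi : ∀ l : ℤ, Integrable (fun u => f (circleLift l u)) μ := fun l =>
    (hint.mono_measure (Measure.le_sum (fun l : ℤ => μ.map (circleLift l)) l)).comp_measurable
      (measurable_circleLift l)
  rw [periodicPullback, integral_sum_measure hint, tsum_eq_sum (s := s)]
  · simp only [hsum, hmap]
    rw [integral_finsetSum _ fun l _ => hi l]
  · intro l hl
    rw [hmap]
    simp [hz l hl]

/-! ### Zeroes of the partition function, with multiplicity, as lifts of roots. -/

open Polynomial in
theorem analyticOrderAt_polynomial_eval {P : ℂ[X]} (hP : P ≠ 0) (r : ℂ) :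
    analyticOrderAt (fun w => P.eval w) r = P.roots.count r := by
  obtain ⟨Q, hQ, hr⟩ := P.exists_eq_pow_rootMultiplicity_mul_and_not_dvd hP r
  have hQr : Q.eval r ≠ 0 := fun h => hr (dvd_iff_isRoot.2 h)
  have h1 : (fun w => P.eval w) =
      ((fun w => w - r) ^ (P.rootMultiplicity r)) * fun w => Q.eval w := by
    funext w
    conv_lhs => rw [hQ]
    simp
  have hQa : AnalyticAt ℂ (fun w => Q.eval w) r := AnalyticOnNhd.eval_polynomial Q r (mem_univ r)
  have hQ0 : analyticOrderAt (fun w => Q.eval w) r = 0 := analyticOrderAt_eq_zero.2 (Or.inr hQr)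
  rw [h1, analyticOrderAt_mul (by fun_prop) hQa, analyticOrderAt_centeredMonomial, hQ0, add_zero, count_roots]

theorem coe_negExpTwo (y : ℝ) : (negExpTwo y : ℂ) = -Complex.exp (2 * (Complex.I * y)) := by
  rw [negExpTwo]
  have : ((-Circle.exp (2 * y) : Circle) : ℂ) = -(Circle.exp (2 * y) : ℂ) := rfl
  rw [this, Circle.coe_exp]
  push_cast
  ring_nf

theorem curieWeissZ_eq_zero_iff {n : ℕ} (hn : n ≠ 0) (β : ℝ) (y : ℝ) :
    curieWeissZ n β (Complex.I * y) = 0 ↔ (leeYangPoly n β).eval (negExpTwo y : ℂ) = 0 := by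
  have h := coe_negExpTwo y
  rw [curieWeissZ_eq hn, h, mul_eq_zero, or_iff_right (Complex.exp_ne_zero _)]

/-- The exponential prefactor never vanishes, and `h ↦ -exp (2h)` has nonzero derivative, so
composing with it preserves the order of vanishing. -/
theorem analyticOrderNatAt_curieWeissZ {n : ℕ} (hn : n ≠ 0) {β : ℝ} (hβ : 0 < β) (y : ℝ) :
    analyticOrderNatAt (curieWeissZ n β) (Complex.I * y) =
      (leeYangPoly n β).roots.count (negExpTwo y : ℂ) := by
  have h := coe_negExpTwo y
  have hP := leeYangPoly_ne_zero hn hβ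
  have h1 : curieWeissZ n β = (fun h => Complex.exp (-(n * h))) *
      ((fun w => (leeYangPoly n β).eval w) ∘ fun h => -Complex.exp (2 * h)) := by
    funext h
    exact curieWeissZ_eq hn β h
  have hg : AnalyticAt ℂ (fun h : ℂ => -Complex.exp (2 * h)) (Complex.I * y) := by fun_prop
  have hPa : ∀ r, AnalyticAt ℂ (fun w => (leeYangPoly n β).eval w) r := fun r =>
    AnalyticOnNhd.eval_polynomial _ r (mem_univ r)
  have hd : deriv (fun h : ℂ => -Complex.exp (2 * h)) (Complex.I * y) ≠ 0 := by
    have : HasDerivAt (fun h : ℂ => -Complex.exp (2 * h))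
        (-(Complex.exp (2 * (Complex.I * y)) * (2 * 1))) (Complex.I * y) :=
      (((hasDerivAt_id _).const_mul 2).cexp).neg
    rw [this.deriv]
    simp
  have he : analyticOrderAt (fun h : ℂ => Complex.exp (-(n * h))) (Complex.I * y) = 0 :=
    analyticOrderAt_eq_zero.2 (Or.inr (Complex.exp_ne_zero _))
  rw [analyticOrderNatAt, h1, analyticOrderAt_mul (by fun_prop) ((hPa _).comp hg),
    analyticOrderAt_comp_of_deriv_ne_zero hg hd, he, zero_add,
    analyticOrderAt_polynomial_eval hP, ← h, ENat.toNat_natCast]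

theorem negExpTwo_circleLift_circleProj {r : ℂ} (hr : ‖r‖ = 1) (l : ℤ) :
    (negExpTwo (circleLift l (circleProj r)) : ℂ) = r := by
  rw [negExpTwo_circleLift, coe_circleProj hr]

/-- The real zeroes `y` correspond bijectively to pairs of a sheet `l` and a distinct root, and
multiplicities match. -/
theorem leeYangMeasure_eq_periodicPullback {n : ℕ} (hn : n ≠ 0) {β : ℝ} (hβ : 0 < β) :
    leeYangMeasure n β = periodicPullback (rootMeasure n β) := by
  have hP := leeYangPoly_ne_zero hn hβ
  have hroot := norm_root_leeYangPoly hn hβ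
  let φ : ℤ × (leeYangPoly n β).roots.toFinset →
      {y : ℝ // curieWeissZ n β (Complex.I * (y : ℂ)) = 0} := fun p =>
    ⟨circleLift p.1 (circleProj p.2), by
      have hr := Multiset.mem_toFinset.1 p.2.2
      rw [curieWeissZ_eq_zero_iff hn, negExpTwo_circleLift_circleProj (hroot _ hr)]
      exact (Polynomial.mem_roots hP).1 hr⟩
  have hφ : Function.Bijective φ := by
    constructor
    · rintro ⟨l, r⟩ ⟨l', r'⟩ h
      have h1 : circleLift l (circleProj r) = circleLift l' (circleProj r') :=
        congrArg Subtype.val h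
      have h2 : r = r' := by
        apply Subtype.ext
        rw [← negExpTwo_circleLift_circleProj (hroot _ (Multiset.mem_toFinset.1 r.2)) l, h1,
          negExpTwo_circleLift_circleProj (hroot _ (Multiset.mem_toFinset.1 r'.2)) l']
      subst h2
      rw [circleLift_eq_add l, circleLift_eq_add l', add_right_inj,
        mul_right_inj' Real.pi_ne_zero, Int.cast_inj] at h1
      rw [h1]
    · rintro ⟨y, hy⟩
      obtain ⟨l, hl⟩ := exists_circleLift_negExpTwo y
      have hmem : (negExpTwo y : ℂ) ∈ (leeYangPoly n β).roots.toFinset :=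
        Multiset.mem_toFinset.2 ((Polynomial.mem_roots hP).2
          ((curieWeissZ_eq_zero_iff hn β y).1 hy))
      refine ⟨(l, ⟨_, hmem⟩), Subtype.ext ?_⟩
      change circleLift l (circleProj (negExpTwo y : ℂ)) = y
      rw [circleProj, Circle.exp_arg, hl]
  ext s hs
  rw [leeYangMeasure, periodicPullback, Measure.smul_apply, Measure.sum_apply _ hs,
    Measure.sum_apply _ hs, ← (Equiv.ofBijective φ hφ).tsum_eq, ENNReal.tsum_prod', smul_eq_mul,
    ← ENNReal.tsum_mul_left]
  refine tsum_congr fun l => ?_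
  rw [Measure.map_apply (measurable_circleLift l) hs, rootMeasure, Measure.smul_apply,
    Measure.finsetSum_apply, smul_eq_mul, tsum_fintype,
    ← Finset.sum_coe_sort (leeYangPoly n β).roots.toFinset]
  congr 1
  refine Finset.sum_congr rfl fun r _ => ?_
  have hr := hroot _ (Multiset.mem_toFinset.1 r.2)
  simp only [Equiv.ofBijective_apply, φ, Measure.smul_apply, smul_eq_mul]
  rw [analyticOrderNatAt_curieWeissZ hn hβ, negExpTwo_circleLift_circleProj hr,
    Measure.dirac_apply' _ hs, Measure.dirac_apply' _ (measurable_circleLift l hs)]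
  rfl

/-- For `n = 0` the partition function is `1`, so the sum of point masses is empty and the infinite
factor `0⁻¹` does no harm. `VagueTendsto` requires local finiteness for this `n` too. -/
theorem leeYangMeasure_zero (β : ℝ) : leeYangMeasure 0 β = 0 := by
  have : IsEmpty {y : ℝ // curieWeissZ 0 β (Complex.I * (y : ℂ)) = 0} :=
    ⟨fun y => by simpa [curieWeissZ] using y.2⟩
  ext s hs
  rw [leeYangMeasure, Measure.smul_apply, Measure.sum_apply _ hs]
  simp

theorem mainTheorem6 (β : ℝ) (hβ : 0 < β) :
    ∃ N : ProbabilityMeasure Circle,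
      (IsFreeUnitaryNormal (4 * β) N ∧
        ∀ N' : ProbabilityMeasure Circle, IsFreeUnitaryNormal (4 * β) N' → N' = N) ∧
      ∃ ν : Measure ℝ,
        (IsPeriodicPullback N ν ∧ ∀ ν' : Measure ℝ, IsPeriodicPullback N ν' → ν' = ν) ∧
        VagueTendsto (fun n => leeYangMeasure n β) ν := by
  obtain ⟨N, hN, hlim⟩ := exists_tendsto_rootProbability hβ
  refine ⟨N, ⟨hN, fun N' hN' => HasSTransform.unique hN' hN⟩, periodicPullback N,
    ⟨isPeriodicPullback_periodicPullback N,
      fun ν' hν' => hν'.unique (isPeriodicPullback_periodicPullback N)⟩, ?_, ?_, ?_⟩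
  · intro n
    rcases n with _ | m
    · rw [leeYangMeasure_zero]; infer_instance
    · rw [leeYangMeasure_eq_periodicPullback m.succ_ne_zero hβ]
      have := isProbabilityMeasure_rootMeasure m.succ_ne_zero hβ
      exact isLocallyFiniteMeasure_periodicPullback _
  · exact isLocallyFiniteMeasure_periodicPullback _
  · intro f hf hc
    -- `rootProbability hβ m` belongs to `m + 1` spins.
    rw [← tendsto_add_atTop_iff_nat 1]
    have h := (ProbabilityMeasure.tendsto_iff_forall_integral_tendsto.1 hlim)
      (BoundedContinuousFunction.mkOfCompact ⟨_, continuous_fibreSum hf hc⟩)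
    rw [integral_periodicPullback _ hf hc]
    refine h.congr fun m => ?_
    have := isProbabilityMeasure_rootMeasure m.succ_ne_zero hβ
    rw [leeYangMeasure_eq_periodicPullback m.succ_ne_zero hβ,
      integral_periodicPullback _ hf hc]
    rfl
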